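/- Let $p_1,p_2\ge 1$ be integers and let $(X_1,X_2)$, with $X_i$ taking values in $\mathbb R^{p_i}$, be a zero-mean jointly Gaussian pair with covariance matrix $Q=\mathbf E[XX^{T}]$, $X=(X_1^T,X_2^T)^T$, and assume $Q\succ0$. For $\Delta_1,\Delta_2\ge 0$ let $$R_{X_1,X_2}(\Delta_1,\Delta_2)=\inf I(X_1,X_2;\widehat X_1,\widehat X_2)\in[0,\infty],$$ the infimum being over all joint laws of $(X_1,X_2,\widehat X_1,\widehat X_2)$ on $\mathbb R^{p_1}\times\mathbb R^{p_2}\times\mathbb R^{p_1}\times\mathbb R^{p_2}$ with the given $(X_1,X_2)$-marginal and $\mathbf E\|X_i-\widehat X_i\|^2\le\Delta_i$, $i=1,2$; let $R_{X_i}(\Delta_i)=\inf I(X_i;\widehat X_i)$, over joint laws of $(X_i,\widehat X_i)$ with the given $X_i$-marginal and $\mathbf E\|X_i-\widehat X_i\|^2\le\Delta_i$, be the marginal rate distortion functions. Logarithms are natural and $\log(a/0)=+\infty$ for $a>0$. Call a symmetric matrix $\Sigma$, with diagonal blocks $\Sigma_{E_1}\in\mathbb R^{p_1\times p_1}$, $\Sigma_{E_2}\in\mathbb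 R^{p_2\times p_2}$, feasible if $0\preceq\Sigma\preceq Q$ and $\operatorname{tr}\Sigma_{E_i}\le\Delta_i$ for $i=1,2$, and optimal for $(\Delta_1,\Delta_2)$ if it minimizes $\frac12\log\frac{\det Q}{\det\Sigma}$ over the feasible matrices. Let $$\mathcal D=\{(\Delta_1,\Delta_2)\in[0,\infty)^2 : Q-\Sigma\succ0 \text{ for some optimal } \Sigma\},$$ and put $\Sigma^*_{E_i}=\frac{\Delta_i}{p_i}I_{p_i}$ and $\Sigma^*=\begin{pmatrix}\Sigma^*_{E_1}&0\\0&\Sigma^*_{E_2}\end{pmatrix}$. (1) For every $(\Delta_1,\Delta_2)\in\mathcal D$, $$R_{X_1,X_2}(\Delta_1,\Delta_2)=\frac12\log\frac{\det Q}{\det\Sigma^*_{E_1}\,\det\Sigma^*_{E_2}}=R_{X_1}(\Delta_1)+R_{X_2}(\Delta_2)-I(X_1;X_2),$$ that is, Gray's lower bound holds with equality. If in addition $R_{X_1,X_2}(\Delta_1,\Delta_2)<\infty$, then $\Sigma^*$ is the unique optimal matrix (so the optimal cross-error covariance is zero), $Q-\Sigma^*\succ0$, and $R_{X_1,X_2}(\Delta_1,\Delta_2)$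 is achieved by $\Sigma^*$: some admissible jointly Gaussian law attains the infimum and satisfies $\mathbf E[X_i\mid\widehat X]=\widehat X_i$ a.s. for $i=1,2$, where $\widehat X=(\widehat X_1,\widehat X_2)$, and, with $E_i=X_i-\mathbf E[X_i\mid\widehat X]$ and $E=(E_1^T,E_2^T)^T$, $\mathbf E[EE^T]=\mathbf E[EE^T\mid\widehat X]=\Sigma^*$ a.s.; in particular $Q_{X_1,X_2\mid\widehat X}=\operatorname{cov}(X_1,X_2\mid\widehat X)=0$. (2) Conversely, if $\Delta_1,\Delta_2\ge0$ and $Q-\Sigma^*\succ0$, then $(\Delta_1,\Delta_2)\in\mathcal D$, $\Sigma^*$ is optimal, and $R_{X_1,X_2}(\Delta_1,\Delta_2)$ is achieved by $\Sigma^*$ in the same sense. -/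

import Mathlib

open MeasureTheory ProbabilityTheory
open scoped ENNReal NNReal

noncomputable section

namespace JointRDF

/-! ### Mutual information and rate distortion functions (abstract alphabets) -/

/-- Mutual information `I(A;B)`, in nats, of a pair `(A,B)` with joint law `π`: the
Kullback-Leibler divergence of the joint law from the product of its marginals. -/
def mutualInfo {α β : Type*} [MeasurableSpace α] [MeasurableSpace β]
    (π : Measure (α × β)) : ℝ≥0∞ :=
  InformationTheory.klDiv π (π.fst.prod π.snd)

/-- Joint laws of `(X, X̂)` whose `X`-marginal is the source law `P` and whose average
distortion is at most `Δ`. -/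
def admissible {𝕏 𝕐 : Type*} [MeasurableSpace 𝕏] [MeasurableSpace 𝕐]
    (P : Measure 𝕏) (d : 𝕏 → 𝕐 → ℝ≥0) (Δ : ℝ) : Set (Measure (𝕏 × 𝕐)) :=
  {π | IsProbabilityMeasure π ∧ π.fst = P ∧
    ∫⁻ z, (d z.1 z.2 : ℝ≥0∞) ∂π ≤ ENNReal.ofReal Δ}

/-- The rate distortion function of a source with law `P`. -/
def rdf {𝕏 𝕐 : Type*} [MeasurableSpace 𝕏] [MeasurableSpace 𝕐]
    (P : Measure 𝕏) (d : 𝕏 → 𝕐 → ℝ≥0) (Δ : ℝ) : ℝ≥0∞ :=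
  ⨅ π ∈ admissible P d Δ, mutualInfo π

/-- Joint laws of `((X₁, X₂), (X̂₁, X̂₂))` whose `(X₁, X₂)`-marginal is the source law `P` and
which meet both individual average distortion constraints. -/
def jointAdmissible {𝕏₁ 𝕏₂ 𝕐₁ 𝕐₂ : Type*} [MeasurableSpace 𝕏₁] [MeasurableSpace 𝕏₂]
    [MeasurableSpace 𝕐₁] [MeasurableSpace 𝕐₂] (P : Measure (𝕏₁ × 𝕏₂))
    (d₁ : 𝕏₁ → 𝕐₁ → ℝ≥0) (d₂ : 𝕏₂ → 𝕐₂ → ℝ≥0) (Δ₁ Δ₂ : ℝ) :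
    Set (Measure ((𝕏₁ × 𝕏₂) × (𝕐₁ × 𝕐₂))) :=
  {π | IsProbabilityMeasure π ∧ π.fst = P ∧
    ∫⁻ z, (d₁ z.1.1 z.2.1 : ℝ≥0∞) ∂π ≤ ENNReal.ofReal Δ₁ ∧
    ∫⁻ z, (d₂ z.1.2 z.2.2 : ℝ≥0∞) ∂π ≤ ENNReal.ofReal Δ₂}

/-- The joint rate distortion function with two individual distortion criteria. -/
def jointRdf {𝕏₁ 𝕏₂ 𝕐₁ 𝕐₂ : Type*} [MeasurableSpace 𝕏₁] [MeasurableSpace 𝕏₂]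
    [MeasurableSpace 𝕐₁] [MeasurableSpace 𝕐₂] (P : Measure (𝕏₁ × 𝕏₂))
    (d₁ : 𝕏₁ → 𝕐₁ → ℝ≥0) (d₂ : 𝕏₂ → 𝕐₂ → ℝ≥0) (Δ₁ Δ₂ : ℝ) : ℝ≥0∞ :=
  ⨅ π ∈ jointAdmissible P d₁ d₂ Δ₁ Δ₂, mutualInfo π

/-! ### Gaussian sources with square-error distortion -/

/-- `ℝᵖ` with its Euclidean norm. -/
abbrev Vec (p : ℕ) : Type := EuclideanSpace ℝ (Fin p)

/-- Square `(p₁ + p₂) × (p₁ + p₂)` real matrices, with their `2 × 2` block structure. -/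
abbrev BlockMat (p₁ p₂ : ℕ) : Type := Matrix (Fin p₁ ⊕ Fin p₂) (Fin p₁ ⊕ Fin p₂) ℝ

/-- Square-error distortion `‖x - x̂‖²`. -/
def sqDist {p : ℕ} (x y : Vec p) : ℝ≥0 := ‖x - y‖₊ ^ 2

/-- The stacked vector `(x₁ᵀ, x₂ᵀ)ᵀ`. -/
def stack {p₁ p₂ : ℕ} (x₁ : Vec p₁) (x₂ : Vec p₂) : Fin p₁ ⊕ Fin p₂ → ℝ :=
  Sum.elim (fun i => x₁ i) (fun j => x₂ j)

/-- `(X₁, X₂) ∈ G(0, Q)`: jointly Gaussian, zero mean, `E[X Xᵀ] = Q` for `X = (X₁ᵀ, X₂ᵀ)ᵀ`. -/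
structure IsCenteredGaussianPair {Ω : Type*} [MeasurableSpace Ω] (μ : Measure Ω) {p₁ p₂ : ℕ}
    (X₁ : Ω → Vec p₁) (X₂ : Ω → Vec p₂) (Q : BlockMat p₁ p₂) : Prop where
  gaussian : HasGaussianLaw (fun ω => (X₁ ω, X₂ ω)) μ
  mean₁ : ∫ ω, X₁ ω ∂μ = 0
  mean₂ : ∫ ω, X₂ ω ∂μ = 0
  cov : ∀ i j, ∫ ω, stack (X₁ ω) (X₂ ω) i * stack (X₁ ω) (X₂ ω) j ∂μ = Q i j

/-- The joint law of `(X₁, X₂)`. -/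
def pairLaw {Ω : Type*} [MeasurableSpace Ω] (μ : Measure Ω) {p₁ p₂ : ℕ}
    (X₁ : Ω → Vec p₁) (X₂ : Ω → Vec p₂) : Measure (Vec p₁ × Vec p₂) :=
  μ.map fun ω => (X₁ ω, X₂ ω)

/-- The joint RDF of a vector source under two square-error criteria. -/
def sqJointRdf {p₁ p₂ : ℕ} (P : Measure (Vec p₁ × Vec p₂)) (Δ₁ Δ₂ : ℝ) : ℝ≥0∞ :=
  jointRdf P (sqDist (p := p₁)) (sqDist (p := p₂)) Δ₁ Δ₂

/-- The (marginal) RDF of a vector source under square-error distortion. -/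
def sqRdf {p : ℕ} (P : Measure (Vec p)) (Δ : ℝ) : ℝ≥0∞ :=
  rdf P (sqDist (p := p)) Δ

/-- `½ log (a / b)` for `a > 0`, `b ≥ 0`, in the extended reals: it is `+∞` when `b = 0`. -/
def halfLogRatio (a b : ℝ) : EReal :=
  ((1 / 2 : ℝ) : EReal) * ENNReal.log (ENNReal.ofReal a / ENNReal.ofReal b)

/-- Feasible error covariances: `Q ⪰ Σ ⪰ 0`, `tr Σ_{E₁} ≤ Δ₁`, `tr Σ_{E₂} ≤ Δ₂`. -/
def feasible {p₁ p₂ : ℕ} (Q : BlockMat p₁ p₂) (Δ₁ Δ₂ : ℝ) : Set (BlockMat p₁ p₂) :=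
  {S | S.PosSemidef ∧ (Q - S).PosSemidef ∧
    S.toBlocks₁₁.trace ≤ Δ₁ ∧ S.toBlocks₂₂.trace ≤ Δ₂}

/-- `S` attains the minimum of `½ log (det Q / det Σ)` over the feasible error covariances. -/
def IsOptimalErrorCov {p₁ p₂ : ℕ} (Q : BlockMat p₁ p₂) (Δ₁ Δ₂ : ℝ) (S : BlockMat p₁ p₂) : Prop :=
  S ∈ feasible Q Δ₁ Δ₂ ∧ IsMinOn (fun T => halfLogRatio Q.det T.det) (feasible Q Δ₁ Δ₂) S

/-- The distortion region on which an optimal error covariance satisfies `Q - Σ ≻ 0`. -/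
def positiveRegion {p₁ p₂ : ℕ} (Q : BlockMat p₁ p₂) : Set (ℝ × ℝ) :=
  {Δ | 0 ≤ Δ.1 ∧ 0 ≤ Δ.2 ∧ ∃ S, IsOptimalErrorCov Q Δ.1 Δ.2 S ∧ (Q - S).PosDef}

/-- `diag (Δ/p, …, Δ/p)`, of size `p × p`. -/
def equalDiag (p : ℕ) (Δ : ℝ) : Matrix (Fin p) (Fin p) ℝ :=
  Matrix.diagonal fun _ => Δ / p

/-- The block-diagonal matrix with blocks `(Δ₁/p₁) I` and `(Δ₂/p₂) I`. -/
def equalBlockDiag (p₁ p₂ : ℕ) (Δ₁ Δ₂ : ℝ) : BlockMat p₁ p₂ :=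
  Matrix.fromBlocks (equalDiag p₁ Δ₁) 0 0 (equalDiag p₂ Δ₂)

/-! ### Estimation errors under a joint law `π` of `((X₁, X₂), (X̂₁, X̂₂))` -/

section Errors

variable {p₁ p₂ : ℕ}

/-- The σ-algebra generated by the reproduction `X̂ = (X̂₁, X̂₂)`. -/
abbrev reprSigma (p₁ p₂ : ℕ) : MeasurableSpace ((Vec p₁ × Vec p₂) × (Vec p₁ × Vec p₂)) :=
  MeasurableSpace.comap Prod.snd inferInstance

/-- A version of `E[X₁ | X̂]`. -/
def condMean₁ (π : Measure ((Vec p₁ × Vec p₂) × (Vec p₁ × Vec p₂))) :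
    (Vec p₁ × Vec p₂) × (Vec p₁ × Vec p₂) → Vec p₁ :=
  π[fun z => z.1.1 | reprSigma p₁ p₂]

/-- A version of `E[X₂ | X̂]`. -/
def condMean₂ (π : Measure ((Vec p₁ × Vec p₂) × (Vec p₁ × Vec p₂))) :
    (Vec p₁ × Vec p₂) × (Vec p₁ × Vec p₂) → Vec p₂ :=
  π[fun z => z.1.2 | reprSigma p₁ p₂]

/-- The stacked error `E = (E₁ᵀ, E₂ᵀ)ᵀ`, with `Eᵢ = Xᵢ - E[Xᵢ | X̂]`. -/
def estErr (π : Measure ((Vec p₁ × Vec p₂) × (Vec p₁ × Vec p₂)))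
    (z : (Vec p₁ × Vec p₂) × (Vec p₁ × Vec p₂)) : Fin p₁ ⊕ Fin p₂ → ℝ :=
  stack (z.1.1 - condMean₁ π z) (z.1.2 - condMean₂ π z)

/-- The error covariance `Σ_{(E₁,E₂)} = E[E Eᵀ]`. -/
def errorCov (π : Measure ((Vec p₁ × Vec p₂) × (Vec p₁ × Vec p₂))) : BlockMat p₁ p₂ :=
  Matrix.of fun i j => ∫ z, estErr π z i * estErr π z j ∂π

/-- A version of the `(i, j)` entry of the conditional covariance
`Q_{(X₁,X₂)|X̂} = E[E Eᵀ | X̂]`. -/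
def condErrorCov (π : Measure ((Vec p₁ × Vec p₂) × (Vec p₁ × Vec p₂))) (i j : Fin p₁ ⊕ Fin p₂) :
    (Vec p₁ × Vec p₂) × (Vec p₁ × Vec p₂) → ℝ :=
  π[fun z => estErr π z i * estErr π z j | reprSigma p₁ p₂]

/-- The joint RDF of the source `P` at `(Δ₁, Δ₂)` is attained by an admissible jointly Gaussian
law with `E[Xᵢ | X̂] = X̂ᵢ` a.s., with error covariance `S`, and with conditional covariance of
`(X₁, X₂)` given `X̂` a.s. equal to `S`. -/
def AchievedByErrorCov (P : Measure (Vec p₁ × Vec p₂)) (Δ₁ Δ₂ : ℝ) (S : BlockMat p₁ p₂) : Prop :=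
  ∃ π ∈ jointAdmissible P sqDist sqDist Δ₁ Δ₂,
    IsGaussian π ∧
    condMean₁ π =ᵐ[π] (fun z => z.2.1) ∧
    condMean₂ π =ᵐ[π] (fun z => z.2.2) ∧
    errorCov π = S ∧
    (∀ i j, condErrorCov π i j =ᵐ[π] fun _ => S i j) ∧
    mutualInfo π = sqJointRdf P Δ₁ Δ₂

end Errors

end JointRDF

end

/-! Put `n = p₁ + p₂`, `D = Σ*`, and let `g_A` be the density of N(0, A). For positive `Δ₁, Δ₂` and
any admissible law, take the test function `log g_D(x - y) - log g_Q(x)` in the variational formula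
for the divergence. Its exponential integrates to 1 against the source law for every fixed `y`, so
I(X; X̂) is at least `½ log (det Q / det D)` plus half of `n - E (X - X̂)ᵀ D⁻¹ (X - X̂)`. That
quadratic form is `Σᵢ (pᵢ/Δᵢ) ‖Xᵢ - X̂ᵢ‖²`, with mean at most `n` (`half_log_le_mutualInfo`,
`le_sqJointRdf`). When `Q - D ⪰ 0`, the channel X = X̂ + U with independent X̂ ∼ N(0, Q - D), U ∼
N(0, D) has exactly this test function as its log-likelihood ratio and attains the bound
(`mutualInfo_gaussianChannel`). The same argument applies to each marginal, since the diagonal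
blocks of `Q - D` are again positive semidefinite. Gray's identity is then the additivity of
logarithms together with `mutualInfo_pair`.

The optimal matrix comes from AM-GM: the two trace constraints bound the trace of `D^{-1/2} S
D^{-1/2}` by `n`, so `det S ≤ det D` with equality only at `S = D`. If an optimal `S` has `Q - S ≻
0`, a short move from `S` towards `D` stays feasible; optimality and concavity of `log det` then
force `S = D` (`eq_equalBlockDiag_of_isOptimal`).

If some `Δᵢ = 0`, then Xᵢ = X̂ᵢ a.s. under every admissible law. As Xᵢ is atomless, every admissible
mutual information is infinite, and both formulas read `∞ = ∞`. -/

noncomputable section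

namespace JointRDF

open Matrix WithLp InformationTheory

/-! ### Divergence and mutual information: variational bound, data processing, infinite values -/

section Information

variable {α β γ : Type*} [MeasurableSpace α] [MeasurableSpace β] [MeasurableSpace γ]

/-- The divergence from `Θ` of a probability measure with density `exp f`. -/
lemma klDiv_withDensity_exp {Θ π : Measure α} [IsProbabilityMeasure Θ] [IsProbabilityMeasure π]
    {f : α → ℝ} (hf : Measurable f)
    (hπ : π = Θ.withDensity fun z => ENNReal.ofReal (Real.exp (f z))) (hfi : Integrable f π) :
    klDiv π Θ = ENNReal.ofReal (∫ z, f z ∂π) ∧ 0 ≤ ∫ z, f z ∂π := by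
  have hac : π ≪ Θ := hπ ▸ withDensity_absolutelyContinuous _ _
  have hmeas : Measurable fun z => ENNReal.ofReal (Real.exp (f z)) := by fun_prop
  have hllr : llr π Θ =ᵐ[π] f := by
    have h := Measure.rnDeriv_withDensity Θ hmeas
    rw [← hπ] at h
    filter_upwards [hac.ae_le h] with z hz
    rw [llr_def]
    simp only [hz]
    rw [ENNReal.toReal_ofReal (Real.exp_pos _).le, Real.log_exp]
  have hint : Integrable (llr π Θ) π := hfi.congr hllr.symm
  have h1 : klDiv π Θ = ENNReal.ofReal (∫ z, f z ∂π) := by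
    rw [klDiv_of_ac_of_integrable hac hint, integral_congr_ae hllr]
    simp
  have h2 : (klDiv π Θ).toReal = ∫ z, f z ∂π := by
    rw [toReal_klDiv hac hint, integral_congr_ae hllr]
    simp
  exact ⟨h1, h2 ▸ ENNReal.toReal_nonneg⟩

/-- Variational lower bound for the divergence. -/
lemma ofReal_integral_le_klDiv {π Θ : Measure α} [IsProbabilityMeasure π] [IsProbabilityMeasure Θ]
    {f : α → ℝ} (hf : Measurable f) (hfi : Integrable f π)
    (hexp : ∫⁻ z, ENNReal.ofReal (Real.exp (f z)) ∂Θ = 1) :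
    ENNReal.ofReal (∫ z, f z ∂π) ≤ klDiv π Θ := by
  by_cases hac : π ≪ Θ
  swap; · simp [klDiv_of_not_ac hac]
  by_cases hint : Integrable (llr π Θ) π
  swap; · simp [klDiv_of_not_integrable hint]
  have hexpi : Integrable (fun z => Real.exp (f z)) Θ := by
    refine ⟨by fun_prop, ?_⟩
    rw [hasFiniteIntegral_iff_ofReal (ae_of_all _ fun z => (Real.exp_pos _).le), hexp]
    exact ENNReal.one_lt_top
  have hexp1 : ∫ z, Real.exp (f z) ∂Θ = 1 := by
    rw [integral_eq_lintegral_of_nonneg_ae (ae_of_all _ fun z => (Real.exp_pos _).le) (by fun_prop),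
      hexp, ENNReal.toReal_one]
  have : IsProbabilityMeasure (Θ.tilted f) := isProbabilityMeasure_tilted hexpi
  have hac' : π ≪ Θ.tilted f := hac.trans (absolutelyContinuous_tilted hexpi)
  -- Gibbs' inequality for `π` against the tilted measure `exp f · Θ`: the log-likelihood ratios
  -- with respect to the two references differ by `f`, since the normalising constant is 1.
  have h0 := integral_llr_add_sub_measure_univ_nonneg hac'
    (integrable_llr_tilted_right hac hfi hint hexpi)
  rw [integral_llr_tilted_right hac hfi hexpi hint, hexp1] at h0
  rw [klDiv_of_ac_of_integrable hac hint]
  refine ENNReal.ofReal_le_ofReal ?_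
  simp at h0 ⊢
  linarith

/-- Normalising along each fibre `y` makes the bound independent of the reproduction law, which is
arbitrary in the converse. -/
lemma ofReal_integral_le_mutualInfo {π : Measure (α × β)} [IsProbabilityMeasure π]
    {f : α × β → ℝ} (hf : Measurable f) (hfi : Integrable f π)
    (hexp : ∀ y, ∫⁻ x, ENNReal.ofReal (Real.exp (f (x, y))) ∂π.fst = 1) :
    ENNReal.ofReal (∫ z, f z ∂π) ≤ mutualInfo π := by
  refine ofReal_integral_le_klDiv hf hfi ?_
  rw [lintegral_prod_symm _ (by fun_prop)]
  simp [hexp]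

/-- Data processing applied to `g` and to its inverse. -/
lemma klDiv_map_equiv (g : α ≃ᵐ β) (μ ν : Measure α) [IsFiniteMeasure μ] [IsFiniteMeasure ν] :
    klDiv (μ.map g) (ν.map g) = klDiv μ ν := by
  refine le_antisymm (klDiv_map_le _ _ g.measurable) ?_
  have h := klDiv_map_le (μ.map g) (ν.map g) g.symm.measurable
  simpa [Measure.map_map g.symm.measurable g.measurable] using h

lemma mutualInfo_map_prodMap_le {α' β' : Type*} [MeasurableSpace α'] [MeasurableSpace β']
    (π : Measure (α × β)) [IsProbabilityMeasure π] {g : α → α'} {h : β → β'}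
    (hg : Measurable g) (hh : Measurable h) :
    mutualInfo (π.map (Prod.map g h)) ≤ mutualInfo π := by
  have h1 : (π.map (Prod.map g h)).fst = π.fst.map g := by
    rw [Measure.fst, Measure.fst, Measure.map_map (by fun_prop) (by fun_prop),
      Measure.map_map (by fun_prop) (by fun_prop)]
    rfl
  have h2 : (π.map (Prod.map g h)).snd = π.snd.map h := by
    rw [Measure.snd, Measure.snd, Measure.map_map (by fun_prop) (by fun_prop),
      Measure.map_map (by fun_prop) (by fun_prop)]
    rfl
  rw [mutualInfo, mutualInfo, h1, h2, Measure.map_prod_map _ _ hg hh]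
  exact klDiv_map_le _ _ (by fun_prop)

/-- Mutual information is infinite when both sides determine a common atomless variable. -/
lemma mutualInfo_eq_top_of_ae_eq [MeasurableEq γ] {π : Measure (α × β)}
    [IsProbabilityMeasure π] {a : α → γ} {b : β → γ} (ha : Measurable a) (hb : Measurable b)
    (hab : ∀ᵐ z ∂π, a z.1 = b z.2) (hna : ∀ c, π.fst {x | a x = c} = 0) :
    mutualInfo π = ∞ := by
  refine klDiv_of_not_ac fun hac => ?_
  have hmeas : MeasurableSet {z : α × β | a z.1 = b z.2} :=
    measurableSet_eq_fun (by fun_prop) (by fun_prop)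
  -- The coincidence set has full `π`-measure, while under the product every slice at fixed second
  -- coordinate is an atom of the law of `a`, hence null. Thus `π` is not absolutely continuous.
  have h0 : (π.fst.prod π.snd) {z | a z.1 = b z.2} = 0 := by
    rw [Measure.prod_apply_symm hmeas]
    simp [hna]
  have h1 : π {z | a z.1 = b z.2} = 0 := hac h0
  have h2 : π {z | a z.1 = b z.2} = 1 := (prob_compl_eq_zero_iff hmeas).1 hab
  simp [h1] at h2

end Information

/-! ### Lebesgue densities of Gaussian laws -/

section GaussianDensity

open scoped MatrixOrder

variable {ι : Type*} [Fintype ι] [DecidableEq ι]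

/-- Logarithm of the Lebesgue density of the centered Gaussian law with covariance `S`. -/
def logDensity (S : Matrix ι ι ℝ) (x : EuclideanSpace ℝ ι) : ℝ :=
  -(1 / 2) * (ofLp x ⬝ᵥ S⁻¹ *ᵥ ofLp x) -
    (1 / 2) * Real.log ((2 * Real.pi) ^ Fintype.card ι * S.det)

@[fun_prop]
lemma continuous_logDensity (S : Matrix ι ι ℝ) : Continuous (logDensity S) := by
  unfold logDensity
  fun_prop

@[fun_prop]
lemma measurable_logDensity (S : Matrix ι ι ℝ) : Measurable (logDensity S) :=
  (continuous_logDensity S).measurable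

lemma logDensity_one (x : EuclideanSpace ℝ ι) : logDensity 1 x =
    -(1 / 2) * ‖x‖ ^ 2 - (1 / 2) * Real.log ((2 * Real.pi) ^ Fintype.card ι) := by
  rw [EuclideanSpace.real_norm_sq_eq]
  simp [logDensity, dotProduct, sq]

lemma exp_logDensity_one (x : EuclideanSpace ℝ ι) : Real.exp (logDensity 1 x) =
    ((2 * Real.pi) ^ (Fintype.card ι / 2 : ℝ))⁻¹ * Real.exp (-(1 / 2) * ‖x‖ ^ 2) := by
  rw [logDensity_one, sub_eq_add_neg, Real.exp_add, mul_comm, ← Real.exp_log (x := (_)⁻¹)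
    (by positivity), Real.log_inv, Real.log_rpow (by positivity), Real.log_pow]
  ring_nf

/-- Both sides have the same characteristic function, by the Gaussian Fourier integral. -/
lemma stdGaussian_eq_withDensity : stdGaussian (EuclideanSpace ℝ ι) =
    volume.withDensity fun x => ENNReal.ofReal (Real.exp (logDensity 1 x)) := by
  have hint : Integrable (fun x : EuclideanSpace ℝ ι => Real.exp (logDensity 1 x)) := by
    have h := (GaussianFourier.integrable_cexp_neg_mul_sq_norm_add (b := (1 / 2 : ℂ))
      (by norm_num) 0 (0 : EuclideanSpace ℝ ι)).norm.const_mul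
      ((2 * Real.pi) ^ (Fintype.card ι / 2 : ℝ))⁻¹
    refine h.congr (ae_of_all _ fun x => ?_)
    simp only [exp_logDensity_one, Complex.norm_exp]
    congr 2
    simp [← Complex.ofReal_pow]
  have : IsFiniteMeasure ((volume : Measure (EuclideanSpace ℝ ι)).withDensity
      fun x => ENNReal.ofReal (Real.exp (logDensity 1 x))) :=
    isFiniteMeasure_withDensity_ofReal hint.2
  refine Measure.ext_of_charFun (funext fun t => ?_)
  rw [charFun_stdGaussian, charFun_apply, integral_withDensity_eq_integral_toReal_smul
    (by fun_prop)
    (ae_of_all _ fun x => ENNReal.ofReal_lt_top)]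
  have h := GaussianFourier.integral_cexp_neg_mul_sq_norm_add (b := (1 / 2 : ℂ))
      (by norm_num) Complex.I t
  have h2 : ∀ x : EuclideanSpace ℝ ι,
      (ENNReal.ofReal (Real.exp (logDensity 1 x))).toReal • Complex.exp (inner ℝ x t * Complex.I) =
      (((2 * Real.pi) ^ (Fintype.card ι / 2 : ℝ))⁻¹ : ℝ) *
        Complex.exp (-(1 / 2 : ℂ) * ‖x‖ ^ 2 + Complex.I * inner ℝ t x) := by
    intro x
    rw [ENNReal.toReal_ofReal (Real.exp_pos _).le, exp_logDensity_one, Complex.exp_add,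
      real_inner_comm, Complex.real_smul]
    push_cast
    ring_nf
  simp_rw [h2]
  rw [integral_const_mul, h]
  have h3 : ((Real.pi : ℂ) / (1 / 2)) = ((2 * Real.pi : ℝ) : ℂ) := by push_cast; ring
  rw [h3, finrank_euclideanSpace, ← Complex.ofReal_natCast (Fintype.card ι),
    ← Complex.ofReal_ofNat, ← Complex.ofReal_div, ← Complex.ofReal_cpow (by positivity), ← mul_assoc,
    ← Complex.ofReal_mul, inv_mul_cancel₀ (by positivity)]
  simp
  ring_nf

lemma det_toEuclideanCLM (A : Matrix ι ι ℝ) :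
    LinearMap.det (toEuclideanCLM (𝕜 := ℝ) A : EuclideanSpace ℝ ι →ₗ[ℝ] EuclideanSpace ℝ ι) =
      A.det := by
  have : (toEuclideanCLM (𝕜 := ℝ) A : EuclideanSpace ℝ ι →ₗ[ℝ] EuclideanSpace ℝ ι) =
      toLin (EuclideanSpace.basisFun ι ℝ).toBasis (EuclideanSpace.basisFun ι ℝ).toBasis A := by
    rw [← toEuclideanLin_eq_toLin_orthonormal]
    rfl
  rw [this, LinearMap.det_toLin]

/-- The law is the image of the standard Gaussian under `S^{1/2}`; the Jacobian `|det S^{1/2}|`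
supplies the factor `det S` in the normalisation. -/
lemma multivariateGaussian_eq_withDensity {S : Matrix ι ι ℝ} (hS : S.PosDef) :
    multivariateGaussian 0 S =
      volume.withDensity fun x => ENNReal.ofReal (Real.exp (logDensity S x)) := by
  set A := CFC.sqrt S with hA
  have hAA : A * A = S := CFC.sqrt_mul_sqrt_self S hS.posSemidef.nonneg
  have hAT : Aᵀ = A := by
    have h := (CFC.sqrt_nonneg S).isSelfAdjoint.star_eq
    rwa [star_eq_conjTranspose, conjTranspose_eq_transpose_of_trivial] at h
  have hdet2 : A.det * A.det = S.det := by rw [← det_mul, hAA]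
  have hA0 : A.det ≠ 0 := fun h => hS.det_pos.ne' (by rw [← hdet2, h, zero_mul])
  have hconj : A * S⁻¹ * A = 1 := by
    have hu : IsUnit A.det := isUnit_iff_ne_zero.2 hA0
    rw [← hAA, Matrix.mul_inv_rev, ← mul_assoc, mul_nonsing_inv _ hu, one_mul, nonsing_inv_mul _ hu]
  set T := toEuclideanCLM (𝕜 := ℝ) A with hT
  have hTx : ∀ x, ofLp (T x) = A *ᵥ ofLp x := fun x => ofLp_toEuclideanCLM _ _
  have hdens : ∀ x, logDensity 1 x = Real.log |A.det| + logDensity S (T x) := by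
    intro x
    have hq : ofLp (T x) ⬝ᵥ S⁻¹ *ᵥ ofLp (T x) = ofLp x ⬝ᵥ ofLp x := by
      have h : A *ᵥ ofLp x = ofLp x ᵥ* A := by rw [← vecMul_transpose, hAT]
      rw [hTx]
      nth_rewrite 1 [h]
      rw [← dotProduct_mulVec, mulVec_mulVec, mulVec_mulVec, hconj, one_mulVec]
    rw [logDensity, logDensity, hq, Real.log_mul (by positivity) hS.det_pos.ne', ← hdet2,
      Real.log_mul hA0 hA0, Real.log_abs]
    simp
    ring
  refine Measure.ext_of_lintegral _ fun g hg => ?_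
  have hm : Measurable fun x : EuclideanSpace ℝ ι =>
      ENNReal.ofReal (Real.exp (logDensity S x)) := by fun_prop
  have hm1 : Measurable fun x : EuclideanSpace ℝ ι =>
      ENNReal.ofReal (Real.exp (logDensity 1 x)) := by fun_prop
  have hmap : (volume : Measure (EuclideanSpace ℝ ι)).map T =
      ENNReal.ofReal |A.det⁻¹| • volume := by
    have h := Measure.map_linearMap_addHaar_eq_smul_addHaar
      (volume : Measure (EuclideanSpace ℝ ι)) (f := (T : _ →ₗ[ℝ] _))
      (by rw [det_toEuclideanCLM]; exact hA0)
    rwa [det_toEuclideanCLM] at h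
  rw [multivariateGaussian, lintegral_map hg (by fun_prop), stdGaussian_eq_withDensity,
    lintegral_withDensity_eq_lintegral_mul _ hm1 (by fun_prop),
    lintegral_withDensity_eq_lintegral_mul _ hm hg]
  simp only [Pi.mul_apply, zero_add, ← hA, ← hT, hdens]
  have h1 : ∀ x, ENNReal.ofReal (Real.exp (Real.log |A.det| + logDensity S (T x))) * g (T x) =
      ENNReal.ofReal |A.det| *
        (fun y => ENNReal.ofReal (Real.exp (logDensity S y)) * g y) (T x) := by
    intro x
    rw [Real.exp_add, Real.exp_log (abs_pos.2 hA0), ENNReal.ofReal_mul (abs_nonneg _), mul_assoc]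
  simp_rw [h1]
  rw [lintegral_const_mul' _ _ ENNReal.ofReal_ne_top, ← lintegral_map (μ := volume)
    (f := fun y => ENNReal.ofReal (Real.exp (logDensity S y)) * g y) (by fun_prop)
    T.continuous.measurable, hmap, lintegral_smul_measure, smul_eq_mul, ← mul_assoc,
    ← ENNReal.ofReal_mul (abs_nonneg _), ← abs_mul, mul_inv_cancel₀ hA0]
  simp

end GaussianDensity

lemma integral_const_sub_half_add_half {Ω : Type*} [MeasurableSpace Ω] {ρ : Measure Ω}
    [IsProbabilityMeasure ρ] {f g : Ω → ℝ} (hf : Integrable f ρ) (hg : Integrable g ρ) (c : ℝ) :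
    Integrable (fun ω => c - 1 / 2 * f ω + 1 / 2 * g ω) ρ ∧
    ∫ ω, (c - 1 / 2 * f ω + 1 / 2 * g ω) ∂ρ =
      c - 1 / 2 * ∫ ω, f ω ∂ρ + 1 / 2 * ∫ ω, g ω ∂ρ := by
  have h1 : Integrable (fun ω => c - 1 / 2 * f ω) ρ := (integrable_const c).sub (hf.const_mul _)
  refine ⟨h1.add (hg.const_mul _), ?_⟩
  rw [integral_add h1 (hg.const_mul _), integral_sub (integrable_const _) (hf.const_mul _),
    integral_const_mul, integral_const_mul]
  simp

/-! ### Moments of Gaussian laws and divergence between them -/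

section GaussianMoments

variable {ι : Type*} [Fintype ι]

lemma memLp_eval (ρ : Measure (EuclideanSpace ℝ ι)) [IsGaussian ρ] (i : ι) :
    MemLp (fun x : EuclideanSpace ℝ ι => x i) 2 ρ :=
  IsGaussian.memLp_dual ρ (EuclideanSpace.proj i) 2 (by simp)

lemma integrable_eval_mul_eval (ρ : Measure (EuclideanSpace ℝ ι)) [IsGaussian ρ] (i j : ι) :
    Integrable (fun x : EuclideanSpace ℝ ι => x i * x j) ρ :=
  (memLp_eval ρ i).integrable_mul (memLp_eval ρ j)

lemma integral_eval_eq_zero {ρ : Measure (EuclideanSpace ℝ ι)} [IsGaussian ρ]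
    (hm : ∫ x, x ∂ρ = 0) (i : ι) : ∫ x : EuclideanSpace ℝ ι, x i ∂ρ = 0 := by
  have h := IsGaussian.integral_dual (μ := ρ) (EuclideanSpace.proj i)
  rw [hm, map_zero] at h
  simpa using h

lemma integrable_quadForm (ρ : Measure (EuclideanSpace ℝ ι)) [IsGaussian ρ]
    (M : Matrix ι ι ℝ) : Integrable (fun x => ofLp x ⬝ᵥ M *ᵥ ofLp x) ρ := by
  simp only [dotProduct, mulVec, Finset.mul_sum]
  refine integrable_finsetSum _ fun i _ => integrable_finsetSum _ fun j _ => ?_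
  exact ((integrable_eval_mul_eval ρ i j).const_mul (M i j)).congr
    (ae_of_all _ fun z => by simp; ring)

variable [DecidableEq ι]

lemma lintegral_exp_logDensity {S : Matrix ι ι ℝ} (hS : S.PosDef) :
    ∫⁻ x, ENNReal.ofReal (Real.exp (logDensity S x)) = 1 := by
  have h : multivariateGaussian 0 S Set.univ = 1 := measure_univ
  rwa [multivariateGaussian_eq_withDensity hS, withDensity_apply _ MeasurableSet.univ,
    setLIntegral_univ] at h

lemma integral_eval_mul_eval_multivariateGaussian {S : Matrix ι ι ℝ} (hS : S.PosSemidef)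
    (i j : ι) : ∫ x, x i * x j ∂(multivariateGaussian 0 S) = S i j := by
  have h := covariance_eval_multivariateGaussian (μ := 0) hS i j
  rw [covariance_eq_sub (memLp_eval _ i) (memLp_eval _ j),
    integral_eval_eq_zero integral_id_multivariateGaussian, zero_mul, sub_zero] at h
  exact h

/-- A centered Gaussian law is determined by its second moments. -/
lemma eq_multivariateGaussian {ρ : Measure (EuclideanSpace ℝ ι)} [IsGaussian ρ]
    {S : Matrix ι ι ℝ} (hS : S.PosSemidef) (hm : ∀ i, ∫ x, x i ∂ρ = 0)
    (hcov : ∀ i j, ∫ x, x i * x j ∂ρ = S i j) : ρ = multivariateGaussian 0 S := by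
  have hm0 : ∫ x, x ∂ρ = 0 := by
    ext i
    have h := IsGaussian.integral_dual (μ := ρ) (EuclideanSpace.proj i)
    simp only [PiLp.proj_apply] at h
    rw [← h, hm, PiLp.zero_apply]
  refine IsGaussian.ext (by simpa using hm0) ?_
  refine ContinuousLinearMap.ext fun x => ContinuousLinearMap.ext fun y => ?_
  have h : ∀ (κ : Measure (EuclideanSpace ℝ ι)) [IsGaussian κ], ∫ z, z ∂κ = 0 →
      (∀ i j, ∫ z, z i * z j ∂κ = S i j) →
      covarianceBilin κ x y = ∑ i, ∑ j, x i * y j * S i j := by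
    intro κ _ hm' hcov'
    have hi : ∀ i j, Integrable (fun z : EuclideanSpace ℝ ι => z i * x i * (z j * y j)) κ :=
      fun i j => ((integrable_eval_mul_eval κ i j).const_mul (x i * y j)).congr
        (ae_of_all _ fun z => by simp; ring)
    rw [covarianceBilin_apply IsGaussian.memLp_two_id]
    simp only [id_eq, hm', sub_zero, PiLp.inner_apply, RCLike.inner_apply, conj_trivial,
      Finset.sum_mul_sum]
    rw [integral_finsetSum _ fun i _ => integrable_finsetSum _ fun j _ => hi i j]
    refine Finset.sum_congr rfl fun i _ => ?_
    rw [integral_finsetSum _ fun j _ => hi i j]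
    refine Finset.sum_congr rfl fun j _ => ?_
    rw [← hcov', ← integral_const_mul]
    congr with z
    ring
  rw [h ρ hm0 hcov, h _ integral_id_multivariateGaussian
    (integral_eval_mul_eval_multivariateGaussian hS)]

lemma integral_quadForm {S : Matrix ι ι ℝ} (hS : S.PosSemidef) (M : Matrix ι ι ℝ) :
    ∫ x, ofLp x ⬝ᵥ M *ᵥ ofLp x ∂(multivariateGaussian 0 S) = (M * S).trace := by
  have hi : ∀ i j, Integrable (fun x : EuclideanSpace ℝ ι => x i * (M i j * x j))
      (multivariateGaussian 0 S) := fun i j =>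
    ((integrable_eval_mul_eval _ i j).const_mul (M i j)).congr
      (ae_of_all _ fun z => by simp; ring)
  simp only [dotProduct, mulVec, Finset.mul_sum]
  rw [integral_finsetSum _ fun i _ => integrable_finsetSum _ fun j _ => hi i j]
  simp only [trace, diag_apply, mul_apply]
  refine Finset.sum_congr rfl fun i _ => ?_
  rw [integral_finsetSum _ fun j _ => hi i j]
  refine Finset.sum_congr rfl fun j _ => ?_
  rw [← integral_eval_mul_eval_multivariateGaussian hS j i, ← integral_const_mul]
  congr with z
  ring

lemma integral_quadForm_inv {S : Matrix ι ι ℝ} (hS : S.PosDef) :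
    ∫ x, ofLp x ⬝ᵥ S⁻¹ *ᵥ ofLp x ∂(multivariateGaussian 0 S) = Fintype.card ι := by
  rw [integral_quadForm hS.posSemidef, nonsing_inv_mul _ (isUnit_iff_ne_zero.2 hS.det_pos.ne'),
    trace_one]

lemma multivariateGaussian_conv {A B : Matrix ι ι ℝ} (hA : A.PosSemidef) (hB : B.PosSemidef) :
    multivariateGaussian 0 A ∗ multivariateGaussian 0 B = multivariateGaussian 0 (A + B) := by
  refine Measure.ext_of_charFun (funext fun t => ?_)
  rw [charFun_conv, charFun_multivariateGaussian hA, charFun_multivariateGaussian hB,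
    charFun_multivariateGaussian (hA.add hB), ← Complex.exp_add, add_mulVec, dotProduct_add]
  push_cast
  simp
  ring_nf

lemma multivariateGaussian_singleton [Nonempty ι] {S : Matrix ι ι ℝ} (hS : S.PosDef)
    (c : EuclideanSpace ℝ ι) : multivariateGaussian 0 S {c} = 0 := by
  rw [multivariateGaussian_eq_withDensity hS]
  exact withDensity_absolutelyContinuous _ _ (measure_singleton c)

/-- The two arguments are kept separate because the converse evaluates one density at the error and
the other at the source. -/
lemma logDensity_sub_logDensity {A B : Matrix ι ι ℝ} (hA : 0 < A.det) (hB : 0 < B.det)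
    (x y : EuclideanSpace ℝ ι) : logDensity A x - logDensity B y =
      1 / 2 * Real.log (B.det / A.det) - 1 / 2 * (ofLp x ⬝ᵥ A⁻¹ *ᵥ ofLp x) +
        1 / 2 * (ofLp y ⬝ᵥ B⁻¹ *ᵥ ofLp y) := by
  have h2 : (2 * Real.pi) ^ Fintype.card ι ≠ 0 := by positivity
  rw [logDensity, logDensity, Real.log_mul h2 hA.ne', Real.log_mul h2 hB.ne',
    Real.log_div hB.ne' hA.ne']
  ring

lemma withDensity_exp_sub_logDensity {A B : Matrix ι ι ℝ} (hA : A.PosDef) (hB : B.PosDef) :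
    multivariateGaussian 0 A = (multivariateGaussian 0 B).withDensity fun x =>
      ENNReal.ofReal (Real.exp (logDensity A x - logDensity B x)) := by
  rw [multivariateGaussian_eq_withDensity hA, multivariateGaussian_eq_withDensity hB,
    ← withDensity_mul _ (by fun_prop) (by fun_prop)]
  congr with x
  rw [Pi.mul_apply, ← ENNReal.ofReal_mul (Real.exp_pos _).le, ← Real.exp_add]
  ring_nf

/-- In general the divergence also contains `½ (tr (B⁻¹A) - n)`; the trace hypothesis removes this
term. -/
lemma klDiv_multivariateGaussian {A B : Matrix ι ι ℝ} (hA : A.PosDef) (hB : B.PosDef)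
    (htr : (B⁻¹ * A).trace = Fintype.card ι) :
    klDiv (multivariateGaussian 0 A) (multivariateGaussian 0 B) =
      ENNReal.ofReal (1 / 2 * Real.log (B.det / A.det)) ∧
      0 ≤ 1 / 2 * Real.log (B.det / A.det) := by
  have hqA := integrable_quadForm (multivariateGaussian 0 A) A⁻¹
  have hqB := integrable_quadForm (multivariateGaussian 0 A) B⁻¹
  have hf : ∫ x, (logDensity A x - logDensity B x) ∂(multivariateGaussian 0 A) =
      1 / 2 * Real.log (B.det / A.det) := by
    simp_rw [logDensity_sub_logDensity hA.det_pos hB.det_pos]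
    rw [(integral_const_sub_half_add_half hqA hqB _).2, integral_quadForm_inv hA,
      integral_quadForm hA.posSemidef, htr]
    ring
  have h := klDiv_withDensity_exp (by fun_prop) (withDensity_exp_sub_logDensity hA hB) (by
    simp_rw [logDensity_sub_logDensity hA.det_pos hB.det_pos]
    exact (integral_const_sub_half_add_half hqA hqB _).1)
  rwa [hf] at h

end GaussianMoments

/-! ### Shannon lower bound -/

section GaussianRateDistortion

variable {ι : Type*} [Fintype ι] [DecidableEq ι] {V W : Type*} [MeasurableSpace V]
  [MeasurableSpace W]

/-- Shannon lower bound for a Gaussian source. -/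
lemma half_log_le_mutualInfo {e : V → EuclideanSpace ℝ ι} {e' : W → EuclideanSpace ℝ ι}
    (he : Measurable e) (he' : Measurable e')
    {Q S : Matrix ι ι ℝ} (hQ : Q.PosDef) (hS : S.PosDef) {π : Measure (V × W)}
    [IsProbabilityMeasure π] (hfst : π.fst.map e = multivariateGaussian 0 Q)
    (hint : Integrable (fun z => ofLp (e z.1 - e' z.2) ⬝ᵥ S⁻¹ *ᵥ ofLp (e z.1 - e' z.2)) π)
    (hle : ∫ z, ofLp (e z.1 - e' z.2) ⬝ᵥ S⁻¹ *ᵥ ofLp (e z.1 - e' z.2) ∂π ≤ Fintype.card ι) :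
    ENNReal.ofReal (1 / 2 * Real.log (Q.det / S.det)) ≤ mutualInfo π := by
  have hmap : (π.map fun z => e z.1) = multivariateGaussian 0 Q := by
    rw [← hfst, Measure.fst, Measure.map_map he measurable_fst]
    rfl
  have hQi : Integrable (fun z => ofLp (e z.1) ⬝ᵥ Q⁻¹ *ᵥ ofLp (e z.1)) π := by
    have h := integrable_quadForm (multivariateGaussian 0 Q) Q⁻¹
    rw [← hmap] at h
    exact h.comp_measurable (by fun_prop)
  have hQv : ∫ z, ofLp (e z.1) ⬝ᵥ Q⁻¹ *ᵥ ofLp (e z.1) ∂π = Fintype.card ι := by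
    have h := integral_quadForm_inv hQ
    rwa [← hmap, integral_map (by fun_prop) (Continuous.aestronglyMeasurable (by fun_prop))] at h
  have hf : ∀ z : V × W, logDensity S (e z.1 - e' z.2) - logDensity Q (e z.1) =
      1 / 2 * Real.log (Q.det / S.det) -
        1 / 2 * (ofLp (e z.1 - e' z.2) ⬝ᵥ S⁻¹ *ᵥ ofLp (e z.1 - e' z.2)) +
        1 / 2 * (ofLp (e z.1) ⬝ᵥ Q⁻¹ *ᵥ ofLp (e z.1)) :=
    fun z => logDensity_sub_logDensity hS.det_pos hQ.det_pos _ _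
  have hval : ∫ z, (logDensity S (e z.1 - e' z.2) - logDensity Q (e z.1)) ∂π =
      1 / 2 * Real.log (Q.det / S.det) -
        1 / 2 * ∫ z, ofLp (e z.1 - e' z.2) ⬝ᵥ S⁻¹ *ᵥ ofLp (e z.1 - e' z.2) ∂π +
        1 / 2 * Fintype.card ι := by
    simp_rw [hf]
    rw [(integral_const_sub_half_add_half hint hQi _).2, hQv]
  refine le_trans (ENNReal.ofReal_le_ofReal ?_) (ofReal_integral_le_mutualInfo
    (f := fun z => logDensity S (e z.1 - e' z.2) - logDensity Q (e z.1)) (by fun_prop) ?_ ?_)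
  · rw [hval]
    linarith
  · simp_rw [hf]
    exact (integral_const_sub_half_add_half hint hQi _).1
  -- The Gaussian density of the source cancels, leaving `∫ g_S(u - e' y) du = 1` by translation
  -- invariance.
  · intro y
    have h := lintegral_map (μ := π.fst) (g := e) (f := fun u => ENNReal.ofReal
      (Real.exp (logDensity S (u - e' y) - logDensity Q u))) (by fun_prop) he
    rw [← h, hfst, multivariateGaussian_eq_withDensity hQ,
      lintegral_withDensity_eq_lintegral_mul _ (by fun_prop) (by fun_prop)]
    simp only [Pi.mul_apply, ← ENNReal.ofReal_mul (Real.exp_pos _).le, ← Real.exp_add,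
      add_sub_cancel]
    rw [lintegral_sub_right_eq_self
      (fun u => ENNReal.ofReal (Real.exp (logDensity S u))) (e' y), lintegral_exp_logDensity hS]

end GaussianRateDistortion

/-! ### The backward Gaussian test channel -/

section GaussianChannel

variable {ι : Type*} [Fintype ι] [DecidableEq ι]

/-- Joint law of `(Y + U, Y)` for independent `Y ∼ N(0, Q - S)` and `U ∼ N(0, S)`. -/
def gaussianChannel (Q S : Matrix ι ι ℝ) : Measure (EuclideanSpace ℝ ι × EuclideanSpace ℝ ι) :=
  ((multivariateGaussian 0 (Q - S)).prod (multivariateGaussian 0 S)).map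
    fun p => (p.1 + p.2, p.1)

variable (Q S : Matrix ι ι ℝ)

instance isGaussian_gaussianChannel : IsGaussian (gaussianChannel Q S) := by
  have h : (fun p : EuclideanSpace ℝ ι × EuclideanSpace ℝ ι => (p.1 + p.2, p.1)) =
      ContinuousLinearMap.prod (ContinuousLinearMap.fst ℝ (EuclideanSpace ℝ ι)
        (EuclideanSpace ℝ ι) + ContinuousLinearMap.snd ℝ _ _) (ContinuousLinearMap.fst ℝ _ _) := rfl
  rw [gaussianChannel, h]
  infer_instance

lemma gaussianChannel_map_sub_snd : (gaussianChannel Q S).map (fun z => (z.1 - z.2, z.2)) =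
    (multivariateGaussian 0 S).prod (multivariateGaussian 0 (Q - S)) := by
  rw [gaussianChannel, Measure.map_map (by fun_prop) (by fun_prop),
    ← Measure.prod_swap (μ := multivariateGaussian 0 (Q - S)) (ν := multivariateGaussian 0 S)]
  congr 1
  ext1 p
  simp [Prod.swap]

lemma gaussianChannel_snd : (gaussianChannel Q S).snd = multivariateGaussian 0 (Q - S) := by
  rw [Measure.snd, gaussianChannel, Measure.map_map (by fun_prop) (by fun_prop)]
  exact Measure.fst_prod

lemma gaussianChannel_map_sub :
    (gaussianChannel Q S).map (fun z => z.1 - z.2) = multivariateGaussian 0 S := by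
  have h : (fun z : EuclideanSpace ℝ ι × EuclideanSpace ℝ ι => z.1 - z.2) =
      Prod.fst ∘ fun z => (z.1 - z.2, z.2) := rfl
  rw [h, ← Measure.map_map (by fun_prop) (by fun_prop), gaussianChannel_map_sub_snd]
  exact Measure.fst_prod

lemma indepFun_gaussianChannel :
    IndepFun (fun z => z.1 - z.2) (fun z => z.2) (gaussianChannel Q S) := by
  rw [indepFun_iff_map_prod_eq_prod_map_map (by fun_prop) (by fun_prop),
    gaussianChannel_map_sub_snd, gaussianChannel_map_sub, ← gaussianChannel_snd]
  rfl

variable {Q S}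

lemma gaussianChannel_fst (hS : S.PosSemidef) (hQS : (Q - S).PosSemidef) :
    (gaussianChannel Q S).fst = multivariateGaussian 0 Q := by
  rw [Measure.fst, gaussianChannel, Measure.map_map (by fun_prop) (by fun_prop)]
  have h := multivariateGaussian_conv hQS hS
  rwa [sub_add_cancel] at h

/-- Given `y`, the source is N(y, S), with density `g_S(x - y) / g_Q(x)` relative to N(0, Q). The
law of `y` itself needs no Lebesgue density, so `Q - S` may be singular. -/
lemma gaussianChannel_eq_withDensity (hQ : Q.PosDef) (hS : S.PosDef) :
    gaussianChannel Q S = ((multivariateGaussian 0 Q).prod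
      (multivariateGaussian 0 (Q - S))).withDensity fun z =>
        ENNReal.ofReal (Real.exp (logDensity S (z.1 - z.2) - logDensity Q z.1)) := by
  refine Measure.ext_of_lintegral _ fun g hg => ?_
  rw [gaussianChannel, lintegral_map hg (by fun_prop), lintegral_prod _ (by fun_prop),
    lintegral_withDensity_eq_lintegral_mul _ (by fun_prop) hg,
    lintegral_prod_symm _ (by fun_prop)]
  refine lintegral_congr fun y => ?_
  simp only [Pi.mul_apply]
  rw [multivariateGaussian_eq_withDensity hS, multivariateGaussian_eq_withDensity hQ,
    lintegral_withDensity_eq_lintegral_mul _ (by fun_prop) (by fun_prop),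
    lintegral_withDensity_eq_lintegral_mul _ (by fun_prop) (by fun_prop)]
  simp only [Pi.mul_apply, ← mul_assoc, ← ENNReal.ofReal_mul (Real.exp_pos _).le, ← Real.exp_add,
    add_sub_cancel]
  rw [← lintegral_sub_right_eq_self _ y]
  simp

/-- Error and source have covariances `S` and `Q`, so both normalised quadratic forms have mean `n`
and cancel; only the log-determinant ratio remains. -/
lemma mutualInfo_gaussianChannel (hQ : Q.PosDef) (hS : S.PosDef) (hQS : (Q - S).PosSemidef) :
    mutualInfo (gaussianChannel Q S) = ENNReal.ofReal (1 / 2 * Real.log (Q.det / S.det)) ∧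
      0 ≤ 1 / 2 * Real.log (Q.det / S.det) := by
  have hint : ∀ {φ : EuclideanSpace ℝ ι × EuclideanSpace ℝ ι → EuclideanSpace ℝ ι}
      {A : Matrix ι ι ℝ}, Measurable φ → A.PosDef →
      (gaussianChannel Q S).map φ = multivariateGaussian 0 A →
      Integrable (fun z => ofLp (φ z) ⬝ᵥ A⁻¹ *ᵥ ofLp (φ z)) (gaussianChannel Q S) ∧
      ∫ z, ofLp (φ z) ⬝ᵥ A⁻¹ *ᵥ ofLp (φ z) ∂(gaussianChannel Q S) = Fintype.card ι := by
    intro φ A hφ hA hmap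
    have h1 := integrable_quadForm (multivariateGaussian 0 A) A⁻¹
    have h2 := integral_quadForm_inv hA
    rw [← hmap] at h1 h2
    rw [integral_map (by fun_prop) (Continuous.aestronglyMeasurable (by fun_prop))] at h2
    exact ⟨h1.comp_measurable hφ, h2⟩
  obtain ⟨hi1, hv1⟩ := hint (by fun_prop) hS (gaussianChannel_map_sub Q S)
  obtain ⟨hi2, hv2⟩ := hint measurable_fst hQ (gaussianChannel_fst hS.posSemidef hQS)
  have hf : ∀ z : EuclideanSpace ℝ ι × EuclideanSpace ℝ ι,
      logDensity S (z.1 - z.2) - logDensity Q z.1 =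
      1 / 2 * Real.log (Q.det / S.det) -
        1 / 2 * (ofLp (z.1 - z.2) ⬝ᵥ S⁻¹ *ᵥ ofLp (z.1 - z.2)) +
        1 / 2 * (ofLp z.1 ⬝ᵥ Q⁻¹ *ᵥ ofLp z.1) :=
    fun z => logDensity_sub_logDensity hS.det_pos hQ.det_pos _ _
  have h := klDiv_withDensity_exp (by fun_prop) (gaussianChannel_eq_withDensity hQ hS) (by
    simp_rw [hf]
    exact (integral_const_sub_half_add_half hi1 hi2 _).1)
  simp_rw [hf] at h
  rw [(integral_const_sub_half_add_half hi1 hi2 _).2, hv1, hv2, sub_add_cancel] at h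
  rwa [mutualInfo, gaussianChannel_fst hS.posSemidef hQS, gaussianChannel_snd]

end GaussianChannel

/-! ### The test channel carried to a linearly equivalent space -/

section TransportedChannel

variable {ι : Type*} [Fintype ι] [DecidableEq ι] {V : Type*} [NormedAddCommGroup V]
  [NormedSpace ℝ V] [MeasurableSpace V] [BorelSpace V]

/-- The Gaussian test channel, in the coordinates `e`. -/
def testChannel (e : V ≃L[ℝ] EuclideanSpace ℝ ι) (Q S : Matrix ι ι ℝ) : Measure (V × V) :=
  (gaussianChannel Q S).map (Prod.map e.symm e.symm)

variable (e : V ≃L[ℝ] EuclideanSpace ℝ ι) (Q S : Matrix ι ι ℝ)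

lemma testChannel_map_prodMap :
    (testChannel e Q S).map (Prod.map e e) = gaussianChannel Q S := by
  rw [testChannel, Measure.map_map (by fun_prop) (by fun_prop), Prod.map_comp_map]
  simp

lemma testChannel_map_sub :
    (testChannel e Q S).map (fun z => e z.1 - e z.2) = multivariateGaussian 0 S := by
  rw [← gaussianChannel_map_sub Q S, ← testChannel_map_prodMap e,
    Measure.map_map (by fun_prop) (by fun_prop)]
  rfl

variable {Q S}

lemma testChannel_fst (hS : S.PosSemidef) (hQS : (Q - S).PosSemidef) {P : Measure V}
    (hP : P.map e = multivariateGaussian 0 Q) : (testChannel e Q S).fst = P := by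
  have h : (testChannel e Q S).fst = (gaussianChannel Q S).fst.map e.symm := by
    rw [testChannel, Measure.fst, Measure.fst, Measure.map_map (by fun_prop) (by fun_prop),
      Measure.map_map (by fun_prop) (by fun_prop)]
    rfl
  rw [h, gaussianChannel_fst hS hQS, ← hP, Measure.map_map (by fun_prop) (by fun_prop)]
  simp

/-- An upper bound suffices: the Shannon lower bound provides the reverse inequality. -/
lemma mutualInfo_testChannel_le (hQ : Q.PosDef) (hS : S.PosDef) (hQS : (Q - S).PosSemidef) :
    mutualInfo (testChannel e Q S) ≤ ENNReal.ofReal (1 / 2 * Real.log (Q.det / S.det)) :=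
  (mutualInfo_map_prodMap_le _ (by fun_prop) (by fun_prop)).trans_eq
    (mutualInfo_gaussianChannel hQ hS hQS).1

variable (Q S) [SecondCountableTopology V]

instance isGaussian_testChannel : IsGaussian (testChannel e Q S) := by
  have h : (Prod.map e.symm e.symm) =
      ((e.symm : EuclideanSpace ℝ ι →L[ℝ] V).prodMap (e.symm : EuclideanSpace ℝ ι →L[ℝ] V)) := rfl
  rw [testChannel, h]
  infer_instance

lemma indepFun_testChannel :
    IndepFun (fun z => e z.1 - e z.2) (fun z => z.2) (testChannel e Q S) := by
  have h : IndepFun (fun z => e z.1 - e z.2) (fun z => e z.2) (testChannel e Q S) := by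
    have h1 := (indepFun_iff_map_prod_eq_prod_map_map (by fun_prop) (by fun_prop)).1
      (indepFun_gaussianChannel Q S)
    rw [← testChannel_map_prodMap e, Measure.map_map (by fun_prop) (by fun_prop),
      Measure.map_map (by fun_prop) (by fun_prop), Measure.map_map (by fun_prop) (by fun_prop)]
      at h1
    exact (indepFun_iff_map_prod_eq_prod_map_map (by fun_prop) (by fun_prop)).2 h1
  have h2 := h.comp measurable_id e.symm.continuous.measurable
  simpa [Function.comp_def] using h2

end TransportedChannel

/-! ### Determinant inequalities under trace constraints -/

section Determinants

variable {ι : Type*} [Fintype ι] [DecidableEq ι]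

lemma eq_one_of_eigenvalues_eq_one {N : Matrix ι ι ℝ} (hN : N.IsHermitian)
    (h : ∀ i, hN.eigenvalues i = 1) : N = 1 := by
  have h1 := hN.spectral_theorem
  have h2 : diagonal (RCLike.ofReal ∘ hN.eigenvalues) = (1 : Matrix ι ι ℝ) := by
    rw [← diagonal_one]
    refine congrArg diagonal (funext fun i => ?_)
    simp [h]
  rwa [h2, map_one] at h1

lemma det_smul_add_smul_one {N : Matrix ι ι ℝ} (hN : N.IsHermitian) (s t : ℝ) :
    (s • N + t • (1 : Matrix ι ι ℝ)).det = ∏ i, (s * hN.eigenvalues i + t) := by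
  have h1 := hN.spectral_theorem
  have h2 : s • N + t • (1 : Matrix ι ι ℝ) =
      Unitary.conjStarAlgAut ℝ _ hN.eigenvectorUnitary
        (diagonal fun i => s * hN.eigenvalues i + t) := by
    have h3 : (diagonal fun i => s * hN.eigenvalues i + t) =
        s • diagonal (RCLike.ofReal ∘ hN.eigenvalues) + t • (1 : Matrix ι ι ℝ) := by
      ext i j
      by_cases hij : i = j <;> simp [hij, one_apply]
    rw [h3, map_add, map_smul, map_smul, map_one, ← h1]
  rw [h2, Unitary.conjStarAlgAut_apply, det_mul_comm, ← mul_assoc]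
  simp

lemma log_det_eq_sum {N : Matrix ι ι ℝ} (hN : N.PosDef) :
    Real.log N.det = ∑ i, Real.log (hN.1.eigenvalues i) := by
  rw [hN.1.det_eq_prod_eigenvalues, Real.log_prod]
  · simp
  · exact fun i _ => by simpa using (hN.eigenvalues_pos i).ne'

/-- AM-GM with its equality case: the terms `λ - 1 - log λ` over the eigenvalues are nonnegative
with nonpositive sum, and each vanishes only at `λ = 1`. -/
lemma eq_one_of_one_le_det {N : Matrix ι ι ℝ} (hN : N.PosSemidef)
    (htr : N.trace ≤ Fintype.card ι) (hdet : 1 ≤ N.det) : N = 1 := by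
  have hpd : N.PosDef := hN.posDef_iff_det_ne_zero.2 (by linarith)
  refine eq_one_of_eigenvalues_eq_one hpd.1 fun i => ?_
  have h0 : ∑ i, (hpd.1.eigenvalues i - 1 - Real.log (hpd.1.eigenvalues i)) ≤ 0 := by
    have h1 := log_det_eq_sum hpd
    have h2 := Real.log_nonneg hdet
    have h3 := hpd.1.trace_eq_sum_eigenvalues
    simp [Finset.sum_sub_distrib] at h3 ⊢
    linarith
  have hnn : ∀ i ∈ Finset.univ,
      0 ≤ hpd.1.eigenvalues i - 1 - Real.log (hpd.1.eigenvalues i) := fun i _ => by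
    have := Real.log_le_sub_one_of_pos (hpd.eigenvalues_pos i)
    linarith
  have h4 := (Finset.sum_eq_zero_iff_of_nonneg hnn).1
    (le_antisymm h0 (Finset.sum_nonneg hnn)) i (Finset.mem_univ i)
  by_contra hne
  have := Real.log_lt_sub_one_of_pos (hpd.eigenvalues_pos i) hne
  linarith

lemma det_le_one {N : Matrix ι ι ℝ} (hN : N.PosSemidef)
    (htr : N.trace ≤ Fintype.card ι) : N.det ≤ 1 := by
  by_contra! h
  have := eq_one_of_one_le_det hN htr h.le
  simp [this] at h

/-- Concavity of `log det` along the segment to the identity, where it is 0: no gain after a step `t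
> 0` forces `t * log det N ≥ 0`, and the AM-GM equality case applies. -/
lemma eq_one_of_det_convexCombo_le {N : Matrix ι ι ℝ} (hN : N.PosDef)
    (htr : N.trace ≤ Fintype.card ι) {t : ℝ} (ht0 : 0 < t) (ht1 : t ≤ 1)
    (hdet : ((1 - t) • N + t • (1 : Matrix ι ι ℝ)).det ≤ N.det) : N = 1 := by
  refine eq_one_of_one_le_det hN.posSemidef htr ?_
  have hpos : ∀ i, 0 < (1 - t) * hN.1.eigenvalues i + t := fun i => by
    have := mul_nonneg (sub_nonneg.2 ht1) (hN.eigenvalues_pos i).le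
    linarith
  have h1 : (1 - t) * Real.log N.det ≤ Real.log ((1 - t) • N + t • (1 : Matrix ι ι ℝ)).det := by
    rw [det_smul_add_smul_one hN.1, Real.log_prod fun i _ => (hpos i).ne', log_det_eq_sum hN,
      Finset.mul_sum]
    refine Finset.sum_le_sum fun i _ => ?_
    have h := strictConcaveOn_log_Ioi.concaveOn.2 (hN.eigenvalues_pos i) (Set.mem_Ioi.2 one_pos)
      (sub_nonneg.2 ht1) ht0.le (by ring)
    simpa using h
  have h2 : Real.log ((1 - t) • N + t • (1 : Matrix ι ι ℝ)).det ≤ Real.log N.det := by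
    refine Real.log_le_log ?_ hdet
    rw [det_smul_add_smul_one hN.1]
    exact Finset.prod_pos fun i _ => hpos i
  have h3 : 0 ≤ t * Real.log N.det := by linarith
  have h4 : 0 ≤ Real.log N.det := nonneg_of_mul_nonneg_right h3 ht0
  exact (Real.log_nonneg_iff hN.det_pos).1 h4

variable {d : ι → ℝ}

/-- `D^{-1/2} S D^{-1/2}` for `D = diagonal d`. -/
def normalize (d : ι → ℝ) (S : Matrix ι ι ℝ) : Matrix ι ι ℝ :=
  diagonal (fun i => (√(d i))⁻¹) * S * diagonal (fun i => (√(d i))⁻¹)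

lemma normalize_apply (S : Matrix ι ι ℝ) (i j : ι) :
    normalize d S i j = (√(d i))⁻¹ * S i j * (√(d j))⁻¹ := by
  simp [normalize]

lemma normalize_diagonal (hd : ∀ i, 0 < d i) : normalize d (diagonal d) = 1 := by
  ext i j
  rw [normalize_apply]
  by_cases hij : i = j
  · subst hij
    have := (Real.sqrt_pos.2 (hd i)).ne'
    rw [diagonal_apply_eq, one_apply_eq]
    nth_rewrite 2 [← Real.mul_self_sqrt (hd i).le]
    field_simp
  · simp [hij]

lemma normalize_injective (hd : ∀ i, 0 < d i) : Function.Injective (normalize d) := by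
  intro S T h
  ext i j
  have h1 := congrFun (congrFun h i) j
  have hi := (Real.sqrt_pos.2 (hd i)).ne'
  have hj := (Real.sqrt_pos.2 (hd j)).ne'
  simpa [normalize_apply, hi, hj] using h1

/-- The weighted trace merges the two blockwise trace constraints into the single one that AM-GM
needs. -/
lemma trace_normalize (hd : ∀ i, 0 < d i) (S : Matrix ι ι ℝ) :
    (normalize d S).trace = ∑ i, S i i / d i := by
  refine Finset.sum_congr rfl fun i _ => ?_
  have := (Real.sqrt_pos.2 (hd i)).ne'
  rw [diag_apply, normalize_apply]
  nth_rewrite 3 [← Real.mul_self_sqrt (hd i).le]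
  field_simp

lemma det_normalize (hd : ∀ i, 0 < d i) (S : Matrix ι ι ℝ) :
    (normalize d S).det = S.det / ∏ i, d i := by
  have h : (∏ i, √(d i)) * ∏ i, √(d i) = ∏ i, d i := by
    rw [← Finset.prod_mul_distrib]
    exact Finset.prod_congr rfl fun i _ => Real.mul_self_sqrt (hd i).le
  have h0 : ∏ i, √(d i) ≠ 0 := Finset.prod_ne_zero_iff.2 fun i _ => (Real.sqrt_pos.2 (hd i)).ne'
  rw [normalize, det_mul, det_mul, det_diagonal, Finset.prod_inv_distrib, ← h]
  field_simp

lemma posSemidef_normalize {S : Matrix ι ι ℝ} (hS : S.PosSemidef) :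
    (normalize d S).PosSemidef := by
  have h := hS.conjTranspose_mul_mul_same (diagonal (fun i => (√(d i))⁻¹))
  simpa [normalize, diagonal_conjTranspose] using h

lemma normalize_add_smul (S T : Matrix ι ι ℝ) (a b : ℝ) :
    normalize d (a • S + b • T) = a • normalize d S + b • normalize d T := by
  simp [normalize, mul_add, add_mul]

lemma det_le_prod_of_sum_div_le (hd : ∀ i, 0 < d i) {S : Matrix ι ι ℝ} (hS : S.PosSemidef)
    (htr : ∑ i, S i i / d i ≤ Fintype.card ι) : S.det ≤ ∏ i, d i := by
  have h := det_le_one (posSemidef_normalize (d := d) hS) (by rwa [trace_normalize hd])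
  rwa [det_normalize hd, div_le_one (Finset.prod_pos fun i _ => hd i)] at h

lemma eq_diagonal_of_prod_le_det (hd : ∀ i, 0 < d i) {S : Matrix ι ι ℝ} (hS : S.PosSemidef)
    (htr : ∑ i, S i i / d i ≤ Fintype.card ι) (hdet : ∏ i, d i ≤ S.det) : S = diagonal d := by
  refine normalize_injective hd ?_
  rw [normalize_diagonal hd]
  refine eq_one_of_one_le_det (posSemidef_normalize hS) (by rwa [trace_normalize hd]) ?_
  rwa [det_normalize hd, one_le_div (Finset.prod_pos fun i _ => hd i)]

lemma eq_diagonal_of_det_convexCombo_le (hd : ∀ i, 0 < d i) {S : Matrix ι ι ℝ} (hS : S.PosDef)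
    (htr : ∑ i, S i i / d i ≤ Fintype.card ι) {t : ℝ} (ht0 : 0 < t) (ht1 : t ≤ 1)
    (hdet : ((1 - t) • S + t • diagonal d).det ≤ S.det) : S = diagonal d := by
  have hp : 0 < ∏ i, d i := Finset.prod_pos fun i _ => hd i
  refine normalize_injective hd ?_
  rw [normalize_diagonal hd]
  refine eq_one_of_det_convexCombo_le ((posSemidef_normalize
    hS.posSemidef).posDef_iff_det_ne_zero.2 ?_) (by rwa [trace_normalize hd]) ht0 ht1 ?_
  · rw [det_normalize hd]
    exact (div_pos hS.det_pos hp).ne'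
  · rw [← normalize_diagonal hd, ← normalize_add_smul, det_normalize hd, det_normalize hd]
    exact div_le_div_of_nonneg_right hdet hp.le

lemma exists_smul_one_le {A : Matrix ι ι ℝ} (hA : A.PosDef) :
    ∃ r : ℝ, 0 < r ∧ (A - r • (1 : Matrix ι ι ℝ)).PosSemidef := by
  have h : ∀ᶠ r in nhdsWithin (0 : ℝ) (Set.Ioi 0), ∀ i, r ≤ hA.1.eigenvalues i :=
    Filter.eventually_all.2 fun i => nhdsWithin_le_nhds (Iic_mem_nhds (hA.eigenvalues_pos i))
  obtain ⟨r, hr, hr0⟩ := (h.and self_mem_nhdsWithin).exists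
  refine ⟨r, hr0, ?_⟩
  have h1 := hA.1.spectral_theorem
  have h2 : A - r • (1 : Matrix ι ι ℝ) =
      Unitary.conjStarAlgAut ℝ _ hA.1.eigenvectorUnitary
        (diagonal fun i => hA.1.eigenvalues i - r) := by
    have h3 : (diagonal fun i => hA.1.eigenvalues i - r) =
        diagonal (RCLike.ofReal ∘ hA.1.eigenvalues) - r • (1 : Matrix ι ι ℝ) := by
      ext i j
      by_cases hij : i = j <;> simp [hij, one_apply]
    rw [h3, map_sub, map_smul, map_one, ← h1]
  rw [h2, Unitary.conjStarAlgAut_apply]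
  exact (PosSemidef.diagonal fun i => sub_nonneg.2 (hr i)).mul_mul_conjTranspose_same _

/-- A small multiple of a diagonal matrix is dominated by a positive definite one. -/
lemma exists_smul_diagonal_le {A : Matrix ι ι ℝ} (hA : A.PosDef) (hd : ∀ i, 0 < d i) :
    ∃ t : ℝ, 0 < t ∧ t ≤ 1 ∧ (A - t • diagonal d).PosSemidef := by
  obtain ⟨r, hr0, hr⟩ := exists_smul_one_le hA
  have hs : 0 ≤ ∑ i, d i := Finset.sum_nonneg fun i _ => (hd i).le
  have hds : ∀ i, d i ≤ ∑ i, d i := fun i =>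
    Finset.single_le_sum (fun j _ => (hd j).le) (Finset.mem_univ i)
  -- This `t` makes `t * d i ≤ r` for all `i`; the `+ 1` keeps the denominator positive even over an
  -- empty index type.
  have ht0 : 0 < min 1 (r / (∑ i, d i + 1)) := by positivity
  refine ⟨min 1 (r / (∑ i, d i + 1)), ht0, min_le_left _ _, ?_⟩
  have h : A - min 1 (r / (∑ i, d i + 1)) • diagonal d = (A - r • (1 : Matrix ι ι ℝ)) +
      diagonal fun i => r - min 1 (r / (∑ i, d i + 1)) * d i := by
    ext i j
    by_cases hij : i = j <;> simp [hij, one_apply]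
  rw [h]
  refine hr.add (PosSemidef.diagonal fun i => sub_nonneg.2 ?_)
  calc min 1 (r / (∑ i, d i + 1)) * d i
      ≤ r / (∑ i, d i + 1) * (∑ i, d i + 1) := by
        refine mul_le_mul (min_le_right _ _) (by linarith [hds i]) (hd i).le (by positivity)
    _ = r := by field_simp

end Determinants

/-! ### The extended-real objective `½ log (a / b)` -/

section HalfLogRatio

lemma halfLogRatio_of_pos {a b : ℝ} (ha : 0 < a) (hb : 0 < b) :
    halfLogRatio a b = ((1 / 2 * Real.log (a / b) : ℝ) : EReal) := by
  rw [halfLogRatio, ← ENNReal.ofReal_div_of_pos hb, ENNReal.log_ofReal_of_pos (div_pos ha hb),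
    EReal.coe_mul]

lemma halfLogRatio_eq_top {a b : ℝ} (ha : 0 < a) (hb : b ≤ 0) : halfLogRatio a b = ⊤ := by
  rw [halfLogRatio, ENNReal.ofReal_of_nonpos hb, ENNReal.div_zero (by simpa using ha),
    ENNReal.log_top]
  exact EReal.coe_mul_top_of_pos (by norm_num)

lemma halfLogRatio_anti {a b b' : ℝ} (ha : 0 < a) (h : b ≤ b') :
    halfLogRatio a b' ≤ halfLogRatio a b := by
  rcases le_or_gt b 0 with hb | hb
  · simp [halfLogRatio_eq_top ha hb]
  · have hb' := hb.trans_le h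
    rw [halfLogRatio_of_pos ha hb, halfLogRatio_of_pos ha hb']
    have := Real.log_le_log (div_pos ha hb') (div_le_div_of_nonneg_left ha.le hb h)
    exact_mod_cast (by linarith : 1 / 2 * Real.log (a / b') ≤ 1 / 2 * Real.log (a / b))

/-- Positivity of `b'` makes the right-hand value finite; comparison with `⊤` would carry no
information. -/
lemma le_of_halfLogRatio_le {a b b' : ℝ} (ha : 0 < a) (hb' : 0 < b')
    (h : halfLogRatio a b ≤ halfLogRatio a b') : b' ≤ b := by
  rw [halfLogRatio_of_pos ha hb'] at h
  rcases le_or_gt b 0 with hb | hb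
  · rw [halfLogRatio_eq_top ha hb, top_le_iff] at h
    exact absurd h (EReal.coe_ne_top _)
  · rw [halfLogRatio_of_pos ha hb, EReal.coe_le_coe_iff, Real.log_div ha.ne' hb.ne',
      Real.log_div ha.ne' hb'.ne'] at h
    exact (Real.log_le_log_iff hb' hb).1 (by linarith)

end HalfLogRatio

/-! ### Optimal error covariances -/

section Optimization

variable {p₁ p₂ : ℕ}

/-- Diagonal of `equalBlockDiag`. -/
def blockLevels (p₁ p₂ : ℕ) (Δ₁ Δ₂ : ℝ) : Fin p₁ ⊕ Fin p₂ → ℝ :=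
  Sum.elim (fun _ => Δ₁ / p₁) (fun _ => Δ₂ / p₂)

lemma equalBlockDiag_eq_diagonal (Δ₁ Δ₂ : ℝ) :
    equalBlockDiag p₁ p₂ Δ₁ Δ₂ = diagonal (blockLevels p₁ p₂ Δ₁ Δ₂) := by
  rw [equalBlockDiag, equalDiag, equalDiag, blockLevels, fromBlocks_diagonal]

lemma det_equalBlockDiag (Δ₁ Δ₂ : ℝ) : (equalBlockDiag p₁ p₂ Δ₁ Δ₂).det =
    (equalDiag p₁ Δ₁).det * (equalDiag p₂ Δ₂).det := by
  rw [equalBlockDiag, det_fromBlocks_zero₂₁]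

variable {Δ₁ Δ₂ : ℝ}

lemma posDef_equalDiag {p : ℕ} (hp : 0 < p) {Δ : ℝ} (hΔ : 0 < Δ) : (equalDiag p Δ).PosDef :=
  PosDef.diagonal fun _ => by positivity

lemma blockLevels_nonneg (hΔ₁ : 0 ≤ Δ₁) (hΔ₂ : 0 ≤ Δ₂) (i : Fin p₁ ⊕ Fin p₂) :
    0 ≤ blockLevels p₁ p₂ Δ₁ Δ₂ i := by
  rcases i with i | i <;> simp only [blockLevels, Sum.elim_inl, Sum.elim_inr] <;> positivity

lemma blockLevels_pos (hp₁ : 0 < p₁) (hp₂ : 0 < p₂) (hΔ₁ : 0 < Δ₁) (hΔ₂ : 0 < Δ₂)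
    (i : Fin p₁ ⊕ Fin p₂) : 0 < blockLevels p₁ p₂ Δ₁ Δ₂ i := by
  rcases i with i | i <;> simp only [blockLevels, Sum.elim_inl, Sum.elim_inr] <;> positivity

lemma posSemidef_equalBlockDiag (hΔ₁ : 0 ≤ Δ₁) (hΔ₂ : 0 ≤ Δ₂) :
    (equalBlockDiag p₁ p₂ Δ₁ Δ₂).PosSemidef := by
  rw [equalBlockDiag_eq_diagonal]
  exact PosSemidef.diagonal (blockLevels_nonneg hΔ₁ hΔ₂)

lemma posDef_equalBlockDiag (hp₁ : 0 < p₁) (hp₂ : 0 < p₂) (hΔ₁ : 0 < Δ₁) (hΔ₂ : 0 < Δ₂) :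
    (equalBlockDiag p₁ p₂ Δ₁ Δ₂).PosDef := by
  rw [equalBlockDiag_eq_diagonal]
  exact PosDef.diagonal (blockLevels_pos hp₁ hp₂ hΔ₁ hΔ₂)

lemma trace_equalDiag {p : ℕ} (hp : 0 < p) (Δ : ℝ) : (equalDiag p Δ).trace = Δ := by
  have : (p : ℝ) ≠ 0 := by positivity
  simp [equalDiag, trace_diagonal]
  field_simp

variable {Q S : BlockMat p₁ p₂}

lemma equalBlockDiag_mem_feasible (hp₁ : 0 < p₁) (hp₂ : 0 < p₂) (hΔ₁ : 0 ≤ Δ₁) (hΔ₂ : 0 ≤ Δ₂)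
    (h : (Q - equalBlockDiag p₁ p₂ Δ₁ Δ₂).PosSemidef) :
    equalBlockDiag p₁ p₂ Δ₁ Δ₂ ∈ feasible Q Δ₁ Δ₂ := by
  refine ⟨posSemidef_equalBlockDiag hΔ₁ hΔ₂, h, ?_, ?_⟩
  · rw [equalBlockDiag, toBlocks_fromBlocks₁₁, trace_equalDiag hp₁]
  · rw [equalBlockDiag, toBlocks_fromBlocks₂₂, trace_equalDiag hp₂]

/-- Block `i` contributes its trace divided by `Δᵢ / pᵢ`, hence at most `pᵢ`. -/
lemma sum_div_blockLevels_le (hp₁ : 0 < p₁) (hp₂ : 0 < p₂) (hΔ₁ : 0 < Δ₁) (hΔ₂ : 0 < Δ₂)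
    (hS : S ∈ feasible Q Δ₁ Δ₂) :
    ∑ i, S i i / blockLevels p₁ p₂ Δ₁ Δ₂ i ≤ Fintype.card (Fin p₁ ⊕ Fin p₂) := by
  have h : ∀ {p : ℕ} {Δ t : ℝ}, 0 < p → 0 < Δ → t ≤ Δ → t / (Δ / p) ≤ p := by
    intro p Δ t hp hΔ ht
    rw [div_le_iff₀ (by positivity)]
    field_simp
    exact ht
  have h1 := h hp₁ hΔ₁ hS.2.2.1
  have h2 := h hp₂ hΔ₂ hS.2.2.2
  rw [Fintype.sum_sum_type]
  simp only [blockLevels, Sum.elim_inl, Sum.elim_inr, ← Finset.sum_div]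
  simp only [trace, diag_apply, toBlocks₁₁, toBlocks₂₂, of_apply] at h1 h2
  simp only [Fintype.card_sum, Fintype.card_fin, Nat.cast_add]
  linarith

lemma eq_equalBlockDiag_of_isOptimal (hp₁ : 0 < p₁) (hp₂ : 0 < p₂) (hΔ₁ : 0 < Δ₁) (hΔ₂ : 0 < Δ₂)
    (hQ : Q.PosDef) (hS : IsOptimalErrorCov Q Δ₁ Δ₂ S) (hQS : (Q - S).PosDef) :
    S = equalBlockDiag p₁ p₂ Δ₁ Δ₂ := by
  have hd := blockLevels_pos hp₁ hp₂ hΔ₁ hΔ₂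
  have hmin := isMinOn_iff.1 hS.2
  -- A small multiple of `D` is feasible with finite cost, so the optimal `S` cannot be singular.
  have hSpd : S.PosDef := by
    obtain ⟨t, ht0, ht1, ht⟩ := exists_smul_diagonal_le hQ hd
    have hD : (t • diagonal (blockLevels p₁ p₂ Δ₁ Δ₂)).PosDef := (PosDef.diagonal hd).smul ht0
    have hfeas : t • diagonal (blockLevels p₁ p₂ Δ₁ Δ₂) ∈ feasible Q Δ₁ Δ₂ := by
      refine ⟨hD.posSemidef, ht, ?_, ?_⟩
      · rw [← equalBlockDiag_eq_diagonal, equalBlockDiag, fromBlocks_smul, toBlocks_fromBlocks₁₁,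
          trace_smul, trace_equalDiag hp₁, smul_eq_mul]
        exact mul_le_of_le_one_left hΔ₁.le ht1
      · rw [← equalBlockDiag_eq_diagonal, equalBlockDiag, fromBlocks_smul, toBlocks_fromBlocks₂₂,
          trace_smul, trace_equalDiag hp₂, smul_eq_mul]
        exact mul_le_of_le_one_left hΔ₂.le ht1
    have h := le_of_halfLogRatio_le hQ.det_pos hD.det_pos (hmin _ hfeas)
    exact hS.1.1.posDef_iff_det_ne_zero.2 (hD.det_pos.trans_le h).ne'
  -- Strict positivity of `Q - S` leaves room for a step `t` towards `D`, although `D ⪯ Q` is not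
  -- yet known.
  obtain ⟨t, ht0, ht1, ht⟩ := exists_smul_diagonal_le hQS hd
  set T := (1 - t) • S + t • diagonal (blockLevels p₁ p₂ Δ₁ Δ₂) with hT
  have hTpd : T.PosDef :=
    (PosDef.diagonal hd).smul ht0 |>.posSemidef_add (hS.1.1.smul (sub_nonneg.2 ht1))
  have htrace : ∀ {a b c : ℝ}, a ≤ c → b ≤ c → (1 - t) * a + t * b ≤ c := by
    intro a b c ha hb
    nlinarith [mul_le_mul_of_nonneg_left ha (sub_nonneg.2 ht1),
      mul_le_mul_of_nonneg_left hb ht0.le]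
  have hfeas : T ∈ feasible Q Δ₁ Δ₂ := by
    refine ⟨hTpd.posSemidef, ?_, ?_, ?_⟩
    · have h : Q - T = (Q - S - t • diagonal (blockLevels p₁ p₂ Δ₁ Δ₂)) + t • S := by
        rw [hT, sub_smul, one_smul]
        abel
      rw [h]
      exact ht.add (hS.1.1.smul ht0.le)
    · have h : T.toBlocks₁₁ = (1 - t) • S.toBlocks₁₁ + t • equalDiag p₁ Δ₁ := by
        ext i j
        simp [hT, ← equalBlockDiag_eq_diagonal, equalBlockDiag, toBlocks₁₁]
      rw [h, trace_add, trace_smul, trace_smul, trace_equalDiag hp₁]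
      exact htrace hS.1.2.2.1 le_rfl
    · have h : T.toBlocks₂₂ = (1 - t) • S.toBlocks₂₂ + t • equalDiag p₂ Δ₂ := by
        ext i j
        simp [hT, ← equalBlockDiag_eq_diagonal, equalBlockDiag, toBlocks₂₂]
      rw [h, trace_add, trace_smul, trace_smul, trace_equalDiag hp₂]
      exact htrace hS.1.2.2.2 le_rfl
  rw [equalBlockDiag_eq_diagonal]
  exact eq_diagonal_of_det_convexCombo_le hd hSpd
    (sum_div_blockLevels_le hp₁ hp₂ hΔ₁ hΔ₂ hS.1) ht0 ht1
    (le_of_halfLogRatio_le hQ.det_pos hTpd.det_pos (hmin _ hfeas))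

/-- AM-GM makes `D` the unique determinant maximiser under the trace constraints alone, so it
remains so among feasible matrices once it is feasible. -/
lemma isOptimalErrorCov_iff (hp₁ : 0 < p₁) (hp₂ : 0 < p₂) (hΔ₁ : 0 < Δ₁) (hΔ₂ : 0 < Δ₂)
    (hQ : Q.PosDef) (h : (Q - equalBlockDiag p₁ p₂ Δ₁ Δ₂).PosSemidef) :
    IsOptimalErrorCov Q Δ₁ Δ₂ S ↔ S = equalBlockDiag p₁ p₂ Δ₁ Δ₂ := by
  have hd := blockLevels_pos hp₁ hp₂ hΔ₁ hΔ₂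
  have hfeas := equalBlockDiag_mem_feasible hp₁ hp₂ hΔ₁.le hΔ₂.le h
  have hdet : (equalBlockDiag p₁ p₂ Δ₁ Δ₂).det = ∏ i, blockLevels p₁ p₂ Δ₁ Δ₂ i := by
    rw [equalBlockDiag_eq_diagonal, det_diagonal]
  constructor
  · intro hS
    have h1 := le_of_halfLogRatio_le hQ.det_pos
      (posDef_equalBlockDiag hp₁ hp₂ hΔ₁ hΔ₂).det_pos (isMinOn_iff.1 hS.2 _ hfeas)
    rw [hdet] at h1
    rw [equalBlockDiag_eq_diagonal]
    exact eq_diagonal_of_prod_le_det hd hS.1.1 (sum_div_blockLevels_le hp₁ hp₂ hΔ₁ hΔ₂ hS.1) h1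
  · rintro rfl
    refine ⟨hfeas, isMinOn_iff.2 fun T hT => halfLogRatio_anti hQ.det_pos ?_⟩
    rw [hdet]
    exact det_le_prod_of_sum_div_le hd hT.1 (sum_div_blockLevels_le hp₁ hp₂ hΔ₁ hΔ₂ hT)

/-- A nonsingular `S` would have a positive diagonal, hence positive block traces. So every feasible
matrix has infinite cost when some `Δᵢ = 0`. -/
lemma det_eq_zero_of_mem_feasible (hp₁ : 0 < p₁) (hp₂ : 0 < p₂) (hΔ : Δ₁ = 0 ∨ Δ₂ = 0)
    (hS : S ∈ feasible Q Δ₁ Δ₂) : S.det = 0 := by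
  by_contra hdet
  have hpd := hS.1.posDef_iff_det_ne_zero.2 hdet
  have hne₁ : Nonempty (Fin p₁) := ⟨⟨0, hp₁⟩⟩
  have hne₂ : Nonempty (Fin p₂) := ⟨⟨0, hp₂⟩⟩
  rcases hΔ with h | h
  · have h1 : 0 < S.toBlocks₁₁.trace :=
      Finset.sum_pos (fun i _ => hpd.diag_pos (i := Sum.inl i)) Finset.univ_nonempty
    linarith [hS.2.2.1]
  · have h1 : 0 < S.toBlocks₂₂.trace :=
      Finset.sum_pos (fun i _ => hpd.diag_pos (i := Sum.inr i)) Finset.univ_nonempty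
    linarith [hS.2.2.2]

lemma isOptimalErrorCov_equalBlockDiag (hp₁ : 0 < p₁) (hp₂ : 0 < p₂) (hΔ₁ : 0 ≤ Δ₁)
    (hΔ₂ : 0 ≤ Δ₂) (hQ : Q.PosDef) (h : (Q - equalBlockDiag p₁ p₂ Δ₁ Δ₂).PosSemidef) :
    IsOptimalErrorCov Q Δ₁ Δ₂ (equalBlockDiag p₁ p₂ Δ₁ Δ₂) := by
  by_cases h0 : Δ₁ = 0 ∨ Δ₂ = 0
  · refine ⟨equalBlockDiag_mem_feasible hp₁ hp₂ hΔ₁ hΔ₂ h, isMinOn_iff.2 fun T hT => ?_⟩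
    rw [halfLogRatio_eq_top hQ.det_pos (det_eq_zero_of_mem_feasible hp₁ hp₂ h0 hT).le]
    exact le_top
  · push Not at h0
    exact (isOptimalErrorCov_iff hp₁ hp₂ (hΔ₁.lt_of_ne' h0.1) (hΔ₂.lt_of_ne' h0.2) hQ h).2 rfl

end Optimization

/-! ### Square-error distortion in coordinates -/

section Distortion

lemma coe_sqDist {p : ℕ} (x y : Vec p) :
    (sqDist x y : ℝ≥0∞) = ENNReal.ofReal (∑ k, (x k - y k) ^ 2) := by
  have h : ∑ k, (x k - y k) ^ 2 = ((‖x - y‖₊ ^ 2 : ℝ≥0) : ℝ) := by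
    rw [NNReal.coe_pow, coe_nnnorm, EuclideanSpace.real_norm_sq_eq]
    rfl
  rw [h, ENNReal.ofReal_coe_nnreal, sqDist]

lemma integrable_of_lintegral_ofReal_le {α : Type*} [MeasurableSpace α] {π : Measure α}
    {f : α → ℝ} (hf : Measurable f) (h0 : ∀ z, 0 ≤ f z) {c : ℝ} (hc : 0 ≤ c)
    (h : ∫⁻ z, ENNReal.ofReal (f z) ∂π ≤ ENNReal.ofReal c) :
    Integrable f π ∧ ∫ z, f z ∂π ≤ c := by
  refine ⟨⟨hf.aestronglyMeasurable, ?_⟩, ?_⟩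
  · rw [hasFiniteIntegral_iff_ofReal (ae_of_all _ h0)]
    exact h.trans_lt ENNReal.ofReal_lt_top
  · rw [integral_eq_lintegral_of_nonneg_ae (ae_of_all _ h0) hf.aestronglyMeasurable]
    exact ENNReal.toReal_le_of_le_ofReal hc h

lemma ae_eq_of_lintegral_sqDist_le_zero {α : Type*} [MeasurableSpace α] {π : Measure α} {p : ℕ}
    {f g : α → Vec p} (hf : Measurable f) (hg : Measurable g)
    (h : ∫⁻ z, (sqDist (f z) (g z) : ℝ≥0∞) ∂π ≤ ENNReal.ofReal 0) : ∀ᵐ z ∂π, f z = g z := by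
  simp only [ENNReal.ofReal_zero, nonpos_iff_eq_zero] at h
  rw [lintegral_eq_zero_iff (by unfold sqDist; fun_prop)] at h
  filter_upwards [h] with z hz
  simpa [sqDist, sub_eq_zero] using hz

variable {ι : Type*} [Fintype ι] [DecidableEq ι]

lemma lintegral_sum_sq_multivariateGaussian {S : Matrix ι ι ℝ} (hS : S.PosSemidef) {κ : Type*}
    [Fintype κ] (f : κ → ι) :
    ∫⁻ u, ENNReal.ofReal (∑ k, (u (f k)) ^ 2) ∂(multivariateGaussian 0 S) =
      ENNReal.ofReal (∑ k, S (f k) (f k)) := by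
  have hi : ∀ k, Integrable (fun u : EuclideanSpace ℝ ι => u (f k) ^ 2)
      (multivariateGaussian 0 S) := fun k => by
    simpa only [sq] using integrable_eval_mul_eval _ (f k) (f k)
  rw [← ofReal_integral_eq_lintegral_ofReal (integrable_finsetSum _ fun k _ => hi k)
    (ae_of_all _ fun u => Finset.sum_nonneg fun k _ => sq_nonneg _),
    integral_finsetSum _ fun k _ => hi k]
  congr 1
  refine Finset.sum_congr rfl fun k _ => ?_
  rw [← integral_eval_mul_eval_multivariateGaussian hS]
  simp only [sq]

lemma dotProduct_diagonal_inv_mulVec {d : ι → ℝ} (hd : ∀ i, 0 < d i) (v : ι → ℝ) :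
    v ⬝ᵥ (diagonal d)⁻¹ *ᵥ v = ∑ i, v i ^ 2 / d i := by
  have h : (diagonal d)⁻¹ = diagonal fun i => (d i)⁻¹ := by
    refine inv_eq_right_inv ?_
    rw [diagonal_mul_diagonal, ← diagonal_one]
    congr 1
    ext i
    exact mul_inv_cancel₀ (hd i).ne'
  rw [h]
  simp only [dotProduct, mulVec_diagonal]
  refine Finset.sum_congr rfl fun i _ => ?_
  rw [div_eq_mul_inv]
  ring

end Distortion

/-! ### Marginal rate distortion functions -/

section SingleSource

variable {p : ℕ} {Q : Matrix (Fin p) (Fin p) ℝ} {Δ : ℝ}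

lemma sqRdf_multivariateGaussian (hp : 0 < p) (hΔ : 0 < Δ) (hQ : Q.PosDef)
    (hQΔ : (Q - equalDiag p Δ).PosSemidef) :
    sqRdf (multivariateGaussian 0 Q) Δ =
      ENNReal.ofReal (1 / 2 * Real.log (Q.det / (equalDiag p Δ).det)) ∧
      0 ≤ 1 / 2 * Real.log (Q.det / (equalDiag p Δ).det) := by
  have hD := posDef_equalDiag hp hΔ
  refine ⟨le_antisymm ?_ ?_, (mutualInfo_gaussianChannel hQ hD hQΔ).2⟩
  · let e := ContinuousLinearEquiv.refl ℝ (Vec p)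
    refine (iInf₂_le (testChannel e Q (equalDiag p Δ)) ⟨inferInstance, ?_, ?_⟩).trans
      (mutualInfo_testChannel_le e hQ hD hQΔ)
    · exact testChannel_fst e hD.posSemidef hQΔ (by simp [e])
    · simp only [coe_sqDist]
      have h := lintegral_sum_sq_multivariateGaussian hD.posSemidef (id : Fin p → Fin p)
      rw [← testChannel_map_sub e Q, lintegral_map (by fun_prop) (by fun_prop)] at h
      exact h.le.trans_eq (congrArg ENNReal.ofReal (trace_equalDiag hp Δ))
  · refine le_iInf₂ fun π hπ => ?_
    obtain ⟨hprob, hfst, hdist⟩ := hπ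
    simp only [coe_sqDist] at hdist
    obtain ⟨hi, hv⟩ := integrable_of_lintegral_ofReal_le (by fun_prop)
      (fun z => Finset.sum_nonneg fun k _ => sq_nonneg _) hΔ.le hdist
    have hquad : ∀ z : Vec p × Vec p, ofLp (z.1 - z.2) ⬝ᵥ (equalDiag p Δ)⁻¹ *ᵥ ofLp (z.1 - z.2) =
        p / Δ * ∑ k, (z.1 k - z.2 k) ^ 2 := by
      intro z
      rw [equalDiag, dotProduct_diagonal_inv_mulVec (fun _ => by positivity), Finset.mul_sum]
      refine Finset.sum_congr rfl fun k _ => ?_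
      simp
      field_simp
    refine half_log_le_mutualInfo measurable_id measurable_id hQ hD (by simpa using hfst) ?_ ?_
    · simp only [id_eq, hquad]
      exact hi.const_mul _
    · simp only [id_eq, hquad]
      rw [integral_const_mul, Fintype.card_fin, div_mul_eq_mul_div, div_le_iff₀ hΔ]
      exact mul_le_mul_of_nonneg_left hv (by positivity)

lemma sqRdf_multivariateGaussian_zero (hp : 0 < p) (hQ : Q.PosDef) :
    sqRdf (multivariateGaussian 0 Q) 0 = ∞ := by
  have : Nonempty (Fin p) := ⟨⟨0, hp⟩⟩
  refine iInf₂_eq_top.2 fun π hπ => ?_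
  obtain ⟨hprob, hfst, hdist⟩ := hπ
  refine mutualInfo_eq_top_of_ae_eq measurable_id measurable_id
    (ae_eq_of_lintegral_sqDist_le_zero measurable_fst measurable_snd hdist) fun c => ?_
  rw [hfst]
  exact multivariateGaussian_singleton hQ c

end SingleSource

/-! ### Joint rate distortion function and mutual information of the pair -/

section PairSource

variable {p₁ p₂ : ℕ}

/-- Stacking as a linear equivalence. -/
def stackEquiv (p₁ p₂ : ℕ) :
    (Vec p₁ × Vec p₂) ≃L[ℝ] EuclideanSpace ℝ (Fin p₁ ⊕ Fin p₂) :=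
  LinearEquiv.toContinuousLinearEquiv
    { toFun := fun x => toLp 2 (stack x.1 x.2)
      invFun := fun v => (toLp 2 fun i => v (Sum.inl i), toLp 2 fun j => v (Sum.inr j))
      map_add' := fun x y => by
        ext i
        rcases i with i | i <;> rfl
      map_smul' := fun c x => by
        ext i
        rcases i with i | i <;> rfl
      left_inv := fun x => rfl
      right_inv := fun v => by
        ext i
        rcases i with i | i <;> rfl }

lemma stackEquiv_inl (x : Vec p₁ × Vec p₂) (i : Fin p₁) :
    stackEquiv p₁ p₂ x (Sum.inl i) = x.1 i := rfl

lemma stackEquiv_inr (x : Vec p₁ × Vec p₂) (i : Fin p₂) :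
    stackEquiv p₁ p₂ x (Sum.inr i) = x.2 i := rfl

variable {Q : BlockMat p₁ p₂} {Δ₁ Δ₂ : ℝ} {P : Measure (Vec p₁ × Vec p₂)}

lemma testChannel_mem_jointAdmissible (hp₁ : 0 < p₁) (hp₂ : 0 < p₂) (hΔ₁ : 0 ≤ Δ₁) (hΔ₂ : 0 ≤ Δ₂)
    (hP : P.map (stackEquiv p₁ p₂) = multivariateGaussian 0 Q)
    (hQΔ : (Q - equalBlockDiag p₁ p₂ Δ₁ Δ₂).PosSemidef) :
    testChannel (stackEquiv p₁ p₂) Q (equalBlockDiag p₁ p₂ Δ₁ Δ₂) ∈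
      jointAdmissible P sqDist sqDist Δ₁ Δ₂ := by
  have hS := posSemidef_equalBlockDiag (p₁ := p₁) (p₂ := p₂) hΔ₁ hΔ₂
  refine ⟨inferInstance, testChannel_fst _ hS hQΔ hP, ?_, ?_⟩
  · simp only [coe_sqDist]
    have h := lintegral_sum_sq_multivariateGaussian hS (Sum.inl : Fin p₁ → _)
    rw [← testChannel_map_sub (stackEquiv p₁ p₂) Q,
      lintegral_map (by fun_prop) (by fun_prop)] at h
    exact h.le.trans_eq (congrArg ENNReal.ofReal (trace_equalDiag hp₁ Δ₁))
  · simp only [coe_sqDist]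
    have h := lintegral_sum_sq_multivariateGaussian hS (Sum.inr : Fin p₂ → _)
    rw [← testChannel_map_sub (stackEquiv p₁ p₂) Q,
      lintegral_map (by fun_prop) (by fun_prop)] at h
    exact h.le.trans_eq (congrArg ENNReal.ofReal (trace_equalDiag hp₂ Δ₂))

/-- With noise covariance `D`, the quadratic form is the combination of the two distortions with
weights `pᵢ / Δᵢ`, of mean at most `p₁ + p₂`. No relation between `D` and `Q` is needed for this
direction. -/
lemma le_sqJointRdf (hp₁ : 0 < p₁) (hp₂ : 0 < p₂) (hΔ₁ : 0 < Δ₁) (hΔ₂ : 0 < Δ₂) (hQ : Q.PosDef)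
    (hP : P.map (stackEquiv p₁ p₂) = multivariateGaussian 0 Q) :
    ENNReal.ofReal (1 / 2 * Real.log (Q.det / (equalBlockDiag p₁ p₂ Δ₁ Δ₂).det)) ≤
      sqJointRdf P Δ₁ Δ₂ := by
  have hD := posDef_equalBlockDiag hp₁ hp₂ hΔ₁ hΔ₂
  refine le_iInf₂ fun π hπ => ?_
  obtain ⟨hprob, hfst, hdist₁, hdist₂⟩ := hπ
  simp only [coe_sqDist] at hdist₁ hdist₂
  obtain ⟨hi₁, hv₁⟩ := integrable_of_lintegral_ofReal_le (by fun_prop)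
    (fun z => Finset.sum_nonneg fun k _ => sq_nonneg _) hΔ₁.le hdist₁
  obtain ⟨hi₂, hv₂⟩ := integrable_of_lintegral_ofReal_le (by fun_prop)
    (fun z => Finset.sum_nonneg fun k _ => sq_nonneg _) hΔ₂.le hdist₂
  let e := stackEquiv p₁ p₂
  have hquad : ∀ z : (Vec p₁ × Vec p₂) × (Vec p₁ × Vec p₂),
      ofLp (e z.1 - e z.2) ⬝ᵥ (equalBlockDiag p₁ p₂ Δ₁ Δ₂)⁻¹ *ᵥ ofLp (e z.1 - e z.2) =
      p₁ / Δ₁ * ∑ k, (z.1.1 k - z.2.1 k) ^ 2 + p₂ / Δ₂ * ∑ k, (z.1.2 k - z.2.2 k) ^ 2 := by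
    intro z
    rw [equalBlockDiag_eq_diagonal,
      dotProduct_diagonal_inv_mulVec (blockLevels_pos hp₁ hp₂ hΔ₁ hΔ₂), Fintype.sum_sum_type,
      Finset.mul_sum, Finset.mul_sum]
    congr 1
    · refine Finset.sum_congr rfl fun k _ => ?_
      simp only [PiLp.sub_apply, e, stackEquiv_inl, blockLevels, Sum.elim_inl]
      field_simp
    · refine Finset.sum_congr rfl fun k _ => ?_
      simp only [PiLp.sub_apply, e, stackEquiv_inr, blockLevels, Sum.elim_inr]
      field_simp
  refine half_log_le_mutualInfo (e := e) (e' := e) (by fun_prop) (by fun_prop) hQ hD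
    (by rw [hfst, hP]) ?_ ?_
  · simp only [hquad]
    exact (hi₁.const_mul _).add (hi₂.const_mul _)
  · simp only [hquad]
    rw [integral_add (hi₁.const_mul _) (hi₂.const_mul _), integral_const_mul, integral_const_mul,
      Fintype.card_sum, Fintype.card_fin, Fintype.card_fin, Nat.cast_add]
    refine add_le_add ?_ ?_
    · rw [div_mul_eq_mul_div, div_le_iff₀ hΔ₁]
      exact mul_le_mul_of_nonneg_left hv₁ (by positivity)
    · rw [div_mul_eq_mul_div, div_le_iff₀ hΔ₂]
      exact mul_le_mul_of_nonneg_left hv₂ (by positivity)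

lemma sqJointRdf_eq (hp₁ : 0 < p₁) (hp₂ : 0 < p₂) (hΔ₁ : 0 < Δ₁) (hΔ₂ : 0 < Δ₂) (hQ : Q.PosDef)
    (hP : P.map (stackEquiv p₁ p₂) = multivariateGaussian 0 Q)
    (hQΔ : (Q - equalBlockDiag p₁ p₂ Δ₁ Δ₂).PosSemidef) :
    sqJointRdf P Δ₁ Δ₂ =
      ENNReal.ofReal (1 / 2 * Real.log (Q.det / (equalBlockDiag p₁ p₂ Δ₁ Δ₂).det)) ∧
      mutualInfo (testChannel (stackEquiv p₁ p₂) Q (equalBlockDiag p₁ p₂ Δ₁ Δ₂)) =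
        sqJointRdf P Δ₁ Δ₂ := by
  have h1 := le_sqJointRdf hp₁ hp₂ hΔ₁ hΔ₂ hQ hP
  have h2 : sqJointRdf P Δ₁ Δ₂ ≤
      mutualInfo (testChannel (stackEquiv p₁ p₂) Q (equalBlockDiag p₁ p₂ Δ₁ Δ₂)) :=
    iInf₂_le _ (testChannel_mem_jointAdmissible hp₁ hp₂ hΔ₁.le hΔ₂.le hP hQΔ)
  have h3 := mutualInfo_testChannel_le (stackEquiv p₁ p₂) hQ
    (posDef_equalBlockDiag hp₁ hp₂ hΔ₁ hΔ₂) hQΔ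
  exact ⟨le_antisymm (h2.trans h3) h1, le_antisymm (h3.trans h1) h2⟩

lemma mutualInfo_eq_top_of_mem_jointAdmissible (hp₁ : 0 < p₁) (hp₂ : 0 < p₂)
    {Q₁ : Matrix (Fin p₁) (Fin p₁) ℝ} {Q₂ : Matrix (Fin p₂) (Fin p₂) ℝ} (hQ₁ : Q₁.PosDef)
    (hQ₂ : Q₂.PosDef) (hP₁ : P.fst = multivariateGaussian 0 Q₁)
    (hP₂ : P.snd = multivariateGaussian 0 Q₂) (hΔ : Δ₁ = 0 ∨ Δ₂ = 0)
    {π : Measure ((Vec p₁ × Vec p₂) × (Vec p₁ × Vec p₂))}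
    (hπ : π ∈ jointAdmissible P sqDist sqDist Δ₁ Δ₂) : mutualInfo π = ∞ := by
  have hne₁ : Nonempty (Fin p₁) := ⟨⟨0, hp₁⟩⟩
  have hne₂ : Nonempty (Fin p₂) := ⟨⟨0, hp₂⟩⟩
  obtain ⟨hprob, hfst, hdist₁, hdist₂⟩ := hπ
  rcases hΔ with rfl | rfl
  · have hae := ae_eq_of_lintegral_sqDist_le_zero (π := π) (f := fun z => z.1.1)
      (g := fun z => z.2.1) (by fun_prop) (by fun_prop) hdist₁
    refine mutualInfo_eq_top_of_ae_eq (a := Prod.fst) (b := Prod.fst) measurable_fst measurable_fst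
      hae fun c => ?_
    have h := multivariateGaussian_singleton hQ₁ c
    rwa [← hP₁, Measure.fst_apply (measurableSet_singleton c), ← hfst] at h
  · have hae := ae_eq_of_lintegral_sqDist_le_zero (π := π) (f := fun z => z.1.2)
      (g := fun z => z.2.2) (by fun_prop) (by fun_prop) hdist₂
    refine mutualInfo_eq_top_of_ae_eq (a := Prod.snd) (b := Prod.snd) measurable_snd measurable_snd
      hae fun c => ?_
    have h := multivariateGaussian_singleton hQ₂ c
    rwa [← hP₂, Measure.snd_apply (measurableSet_singleton c), ← hfst] at h

lemma trace_fromBlocks_eq {m n : Type*} [Fintype m] [Fintype n] (A : Matrix m m ℝ)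
    (B : Matrix m n ℝ) (C : Matrix n m ℝ) (D : Matrix n n ℝ) :
    (fromBlocks A B C D).trace = A.trace + D.trace := by
  simp [trace, Fintype.sum_sum_type]

/-- The product of the marginals is N(0, B) with `B` the block-diagonal part of `Q`; since the
diagonal blocks agree, `tr (B⁻¹Q) = n` and the divergence is a log-determinant ratio. -/
lemma mutualInfo_pair (hQ : Q.PosDef)
    (hP : P.map (stackEquiv p₁ p₂) = multivariateGaussian 0 Q)
    (hP₁ : P.fst = multivariateGaussian 0 Q.toBlocks₁₁)
    (hP₂ : P.snd = multivariateGaussian 0 Q.toBlocks₂₂)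
    (hQ₁ : Q.toBlocks₁₁.PosDef) (hQ₂ : Q.toBlocks₂₂.PosDef) :
    mutualInfo P = ENNReal.ofReal
        (1 / 2 * Real.log (Q.toBlocks₁₁.det * Q.toBlocks₂₂.det / Q.det)) ∧
      0 ≤ 1 / 2 * Real.log (Q.toBlocks₁₁.det * Q.toBlocks₂₂.det / Q.det) := by
  set B : BlockMat p₁ p₂ := fromBlocks Q.toBlocks₁₁ 0 0 Q.toBlocks₂₂ with hB
  have hBdet : B.det = Q.toBlocks₁₁.det * Q.toBlocks₂₂.det := det_fromBlocks_zero₂₁ _ _ _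
  have hBpd : B.PosDef := by
    refine PosSemidef.posDef_iff_det_ne_zero ?_ |>.2 ?_
    · refine PosSemidef.of_dotProduct_mulVec_nonneg ?_ fun v => ?_
      · rw [IsHermitian, hB, fromBlocks_conjTranspose, hQ₁.1, hQ₂.1]
        simp
      · have h1 := hQ₁.posSemidef.dotProduct_mulVec_nonneg (v ∘ Sum.inl)
        have h2 := hQ₂.posSemidef.dotProduct_mulVec_nonneg (v ∘ Sum.inr)
        rw [hB, fromBlocks_mulVec]
        simp only [dotProduct, Fintype.sum_sum_type] at h1 h2 ⊢
        simpa using add_nonneg h1 h2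
    · rw [hBdet]
      exact (mul_pos hQ₁.det_pos hQ₂.det_pos).ne'
  have hBinv : B⁻¹ = fromBlocks Q.toBlocks₁₁⁻¹ 0 0 Q.toBlocks₂₂⁻¹ := by
    refine inv_eq_right_inv ?_
    rw [hB, fromBlocks_multiply, mul_nonsing_inv _ (isUnit_iff_ne_zero.2 hQ₁.det_pos.ne'),
      mul_nonsing_inv _ (isUnit_iff_ne_zero.2 hQ₂.det_pos.ne')]
    simp
  have htr : (B⁻¹ * Q).trace = Fintype.card (Fin p₁ ⊕ Fin p₂) := by
    conv_lhs => rw [hBinv, ← fromBlocks_toBlocks Q, fromBlocks_multiply]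
    simp only [toBlocks_fromBlocks₁₁, toBlocks_fromBlocks₂₂, Matrix.zero_mul, add_zero, zero_add]
    rw [trace_fromBlocks_eq, nonsing_inv_mul _ (isUnit_iff_ne_zero.2 hQ₁.det_pos.ne'),
      nonsing_inv_mul _ (isUnit_iff_ne_zero.2 hQ₂.det_pos.ne')]
    simp
  have hprod : (P.fst.prod P.snd).map (stackEquiv p₁ p₂) = multivariateGaussian 0 B := by
    rw [hP₁, hP₂]
    have hm₁ := fun i => integral_eval_eq_zero
      (integral_id_multivariateGaussian (μ := 0) (S := Q.toBlocks₁₁)) i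
    have hm₂ := fun i => integral_eval_eq_zero
      (integral_id_multivariateGaussian (μ := 0) (S := Q.toBlocks₂₂)) i
    refine eq_multivariateGaussian hBpd.posSemidef (fun i => ?_) fun i j => ?_
    · rw [integral_map (by fun_prop) (by fun_prop)]
      rcases i with i | i
      · simp only [stackEquiv_inl]
        rw [integral_fun_fst (fun x : Vec p₁ => x i), hm₁, smul_zero]
      · simp only [stackEquiv_inr]
        rw [integral_fun_snd (fun x : Vec p₂ => x i), hm₂, smul_zero]
    · rw [integral_map (by fun_prop) (Continuous.aestronglyMeasurable (by fun_prop))]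
      rcases i with i | i <;> rcases j with j | j <;> simp only [stackEquiv_inl, stackEquiv_inr]
      · rw [integral_fun_fst (fun x : Vec p₁ => x i * x j),
          integral_eval_mul_eval_multivariateGaussian hQ₁.posSemidef]
        simp [hB]
      · rw [integral_prod_mul (fun x : Vec p₁ => x i) (fun x : Vec p₂ => x j), hm₁]
        simp [hB]
      · simp_rw [mul_comm]
        rw [integral_prod_mul (fun x : Vec p₁ => x j) (fun x : Vec p₂ => x i), hm₁]
        simp [hB]
      · rw [integral_fun_snd (fun x : Vec p₂ => x i * x j),
          integral_eval_mul_eval_multivariateGaussian hQ₂.posSemidef]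
        simp [hB]
  have h := klDiv_multivariateGaussian hQ hBpd htr
  have hfin₁ : IsFiniteMeasure P.fst := hP₁ ▸ inferInstance
  have hfin₂ : IsFiniteMeasure P.snd := hP₂ ▸ inferInstance
  have hfin : IsFiniteMeasure P := ⟨by
    rw [← Measure.fst_univ]
    exact measure_lt_top _ _⟩
  rw [← hP, ← hprod, hBdet] at h
  rw [mutualInfo, ← klDiv_map_equiv (stackEquiv p₁ p₂).toHomeomorph.toMeasurableEquiv]
  exact h

end PairSource

/-! ### Conditional means and error covariances of the test channel -/

section Achievability

lemma condExp_comp_of_indepFun {Ω α β E : Type*} [MeasurableSpace Ω] [MeasurableSpace α]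
    [MeasurableSpace β] [NormedAddCommGroup E] [NormedSpace ℝ E] [CompleteSpace E]
    [MeasurableSpace E] [BorelSpace E] [SecondCountableTopology E] {ρ : Measure Ω}
    [IsProbabilityMeasure ρ] {W : Ω → α} {Y : Ω → β} (hW : Measurable W) (hY : Measurable Y)
    (h : IndepFun W Y ρ) {φ : α → E} (hφ : Measurable φ) :
    ρ[fun ω => φ (W ω) | MeasurableSpace.comap Y inferInstance] =ᵐ[ρ]
      fun _ => ∫ ω, φ (W ω) ∂ρ :=
  condExp_indep_eq hW.comap_le hY.comap_le
    (hφ.comp (comap_measurable W)).stronglyMeasurable ((IndepFun_iff_Indep _ _ _).1 h)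

section Channel

variable {ι V E : Type*} [Fintype ι] [DecidableEq ι] [NormedAddCommGroup V] [NormedSpace ℝ V]
  [MeasurableSpace V] [BorelSpace V] [NormedAddCommGroup E] [NormedSpace ℝ E]
  (e : V ≃L[ℝ] EuclideanSpace ℝ ι) (Q S : Matrix ι ι ℝ)

lemma integral_comp_testChannel {φ : EuclideanSpace ℝ ι → E} (hφ : StronglyMeasurable φ) :
    ∫ z, φ (e z.1 - e z.2) ∂(testChannel e Q S) = ∫ u, φ u ∂(multivariateGaussian 0 S) := by
  rw [← testChannel_map_sub e Q S, integral_map (by fun_prop) hφ.aestronglyMeasurable]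

/-- In the Gaussian test channel the reproduction is the conditional mean of the source. -/
lemma condExp_testChannel [CompleteSpace V] [SecondCountableTopology V] [CompleteSpace E]
    [MeasurableSpace E] [BorelSpace E] [SecondCountableTopology E] (ψ : V →L[ℝ] E) :
    (testChannel e Q S)[fun z => ψ z.1 | MeasurableSpace.comap Prod.snd inferInstance]
      =ᵐ[testChannel e Q S] fun z => ψ z.2 := by
  set π := testChannel e Q S with hπ
  let L : EuclideanSpace ℝ ι →L[ℝ] E := ψ.comp (e.symm : EuclideanSpace ℝ ι →L[ℝ] V)
  have hid : Integrable (fun z => z) π := IsGaussian.integrable_fun_id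
  have hind := condExp_comp_of_indepFun (by fun_prop) (by fun_prop)
    (indepFun_testChannel e Q S) (φ := L) (by fun_prop)
  have hzero : ∫ z, L (e z.1 - e z.2) ∂π = 0 := by
    rw [hπ, integral_comp_testChannel e Q S L.continuous.stronglyMeasurable,
      L.integral_comp_comm IsGaussian.integrable_fun_id, integral_id_multivariateGaussian, map_zero]
  have hL : ∀ z : V × V, L (e z.1 - e z.2) = ψ z.1 - ψ z.2 := by
    intro z
    simp [L]
  -- Source = reproduction + error: the first term is measurable for the conditioning σ-algebra, the
  -- second is independent of it and centred.
  have hsplit : (fun z : V × V => ψ z.1) = (fun z => ψ z.2) + fun z => L (e z.1 - e z.2) := by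
    ext1 z
    simp [hL]
  have hmeas : StronglyMeasurable[MeasurableSpace.comap Prod.snd inferInstance]
      (fun z : V × V => ψ z.2) :=
    (ψ.continuous.measurable.comp (comap_measurable Prod.snd)).stronglyMeasurable
  have hi1 : Integrable (fun z : V × V => ψ z.2) π := ψ.integrable_comp hid.snd
  have hi2 : Integrable (fun z => L (e z.1 - e z.2)) π := by
    simp only [hL]
    exact (ψ.integrable_comp hid.fst).sub hi1
  have hadd := condExp_add hi1 hi2 (MeasurableSpace.comap Prod.snd inferInstance)
  rw [hsplit]
  filter_upwards [hadd, hind] with z h1 h2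
  rw [h1, Pi.add_apply, condExp_of_stronglyMeasurable measurable_snd.comap_le hmeas hi1, h2, hzero, add_zero]

end Channel

variable {p₁ p₂ : ℕ} {Q S : BlockMat p₁ p₂}

lemma condMean₁_testChannel : condMean₁ (testChannel (stackEquiv p₁ p₂) Q S)
    =ᵐ[testChannel (stackEquiv p₁ p₂) Q S] fun z => z.2.1 :=
  condExp_testChannel (stackEquiv p₁ p₂) Q S (ContinuousLinearMap.fst ℝ (Vec p₁) (Vec p₂))

lemma condMean₂_testChannel : condMean₂ (testChannel (stackEquiv p₁ p₂) Q S)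
    =ᵐ[testChannel (stackEquiv p₁ p₂) Q S] fun z => z.2.2 :=
  condExp_testChannel (stackEquiv p₁ p₂) Q S (ContinuousLinearMap.snd ℝ (Vec p₁) (Vec p₂))

lemma estErr_testChannel : estErr (testChannel (stackEquiv p₁ p₂) Q S)
    =ᵐ[testChannel (stackEquiv p₁ p₂) Q S]
      fun z => ofLp (stackEquiv p₁ p₂ z.1 - stackEquiv p₁ p₂ z.2) := by
  filter_upwards [condMean₁_testChannel, condMean₂_testChannel] with z h1 h2
  ext i
  rw [estErr, h1, h2]
  rcases i with i | i <;> rfl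

lemma integral_mul_testChannel (hS : S.PosSemidef) (i j : Fin p₁ ⊕ Fin p₂) :
    ∫ z, (stackEquiv p₁ p₂ z.1 - stackEquiv p₁ p₂ z.2) i *
      (stackEquiv p₁ p₂ z.1 - stackEquiv p₁ p₂ z.2) j ∂(testChannel (stackEquiv p₁ p₂) Q S) =
      S i j := by
  rw [integral_comp_testChannel (φ := fun u => u i * u j) (stackEquiv p₁ p₂) Q S
    (Continuous.stronglyMeasurable (by fun_prop)), integral_eval_mul_eval_multivariateGaussian hS]

lemma errorCov_testChannel (hS : S.PosSemidef) :
    errorCov (testChannel (stackEquiv p₁ p₂) Q S) = S := by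
  ext i j
  rw [errorCov, of_apply, ← integral_mul_testChannel (Q := Q) hS i j]
  refine integral_congr_ae ?_
  filter_upwards [estErr_testChannel] with z hz
  rw [hz]

/-- The error is independent of the reproduction, so conditioning leaves its second moments
unchanged. -/
lemma condErrorCov_testChannel (hS : S.PosSemidef) (i j : Fin p₁ ⊕ Fin p₂) :
    condErrorCov (testChannel (stackEquiv p₁ p₂) Q S) i j
      =ᵐ[testChannel (stackEquiv p₁ p₂) Q S] fun _ => S i j := by
  have h1 : (fun z => estErr (testChannel (stackEquiv p₁ p₂) Q S) z i *
      estErr (testChannel (stackEquiv p₁ p₂) Q S) z j) =ᵐ[testChannel (stackEquiv p₁ p₂) Q S]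
      fun z => (stackEquiv p₁ p₂ z.1 - stackEquiv p₁ p₂ z.2) i *
        (stackEquiv p₁ p₂ z.1 - stackEquiv p₁ p₂ z.2) j := by
    filter_upwards [estErr_testChannel] with z hz
    rw [hz]
  refine (condExp_congr_ae h1).trans ?_
  rw [← integral_mul_testChannel (Q := Q) hS i j]
  exact condExp_comp_of_indepFun (by fun_prop) (by fun_prop)
    (indepFun_testChannel (stackEquiv p₁ p₂) Q S) (φ := fun u => u i * u j) (by fun_prop)

lemma achievedByErrorCov_equalBlockDiag (hp₁ : 0 < p₁) (hp₂ : 0 < p₂) {Δ₁ Δ₂ : ℝ} (hΔ₁ : 0 ≤ Δ₁)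
    (hΔ₂ : 0 ≤ Δ₂) {P : Measure (Vec p₁ × Vec p₂)}
    (hP : P.map (stackEquiv p₁ p₂) = multivariateGaussian 0 Q)
    (hQΔ : (Q - equalBlockDiag p₁ p₂ Δ₁ Δ₂).PosSemidef)
    (hI : mutualInfo (testChannel (stackEquiv p₁ p₂) Q (equalBlockDiag p₁ p₂ Δ₁ Δ₂)) =
      sqJointRdf P Δ₁ Δ₂) :
    AchievedByErrorCov P Δ₁ Δ₂ (equalBlockDiag p₁ p₂ Δ₁ Δ₂) :=
  ⟨_, testChannel_mem_jointAdmissible hp₁ hp₂ hΔ₁ hΔ₂ hP hQΔ, inferInstance,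
    condMean₁_testChannel, condMean₂_testChannel,
    errorCov_testChannel (posSemidef_equalBlockDiag hΔ₁ hΔ₂),
    condErrorCov_testChannel (posSemidef_equalBlockDiag hΔ₁ hΔ₂), hI⟩

end Achievability

/-! ### Identification of the source laws -/

section Source

lemma map_eq_multivariateGaussian {Ω ι : Type*} [MeasurableSpace Ω] [Fintype ι] [DecidableEq ι]
    {μ : Measure Ω} {X : Ω → EuclideanSpace ℝ ι} (hX : HasGaussianLaw X μ) {S : Matrix ι ι ℝ}
    (hS : S.PosSemidef) (hm : ∀ i, ∫ ω, X ω i ∂μ = 0)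
    (hcov : ∀ i j, ∫ ω, X ω i * X ω j ∂μ = S i j) : μ.map X = multivariateGaussian 0 S := by
  have : IsGaussian (μ.map X) := hX.isGaussian_map
  refine eq_multivariateGaussian hS (fun i => ?_) fun i j => ?_
  · rw [integral_map hX.aemeasurable (by fun_prop), hm]
  · rw [integral_map hX.aemeasurable (Continuous.aestronglyMeasurable (by fun_prop)), hcov]

variable {Ω : Type*} [MeasurableSpace Ω] {μ : Measure Ω} {p₁ p₂ : ℕ} {X₁ : Ω → Vec p₁}
  {X₂ : Ω → Vec p₂} {Q : BlockMat p₁ p₂}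

lemma integral_eval_of_integral_eq_zero {p : ℕ} {X : Ω → Vec p} (hX : Integrable X μ)
    (hm : ∫ ω, X ω ∂μ = 0) (i : Fin p) : ∫ ω, X ω i ∂μ = 0 := by
  have h := (EuclideanSpace.proj i : Vec p →L[ℝ] ℝ).integral_comp_comm hX
  rw [hm, map_zero] at h
  simpa using h

namespace IsCenteredGaussianPair

lemma integral_stack (hX : IsCenteredGaussianPair μ X₁ X₂ Q) (i : Fin p₁ ⊕ Fin p₂) :
    ∫ ω, stack (X₁ ω) (X₂ ω) i ∂μ = 0 := by
  rcases i with i | i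
  · exact integral_eval_of_integral_eq_zero hX.gaussian.fst.integrable hX.mean₁ i
  · exact integral_eval_of_integral_eq_zero hX.gaussian.snd.integrable hX.mean₂ i

lemma map_stackEquiv (hX : IsCenteredGaussianPair μ X₁ X₂ Q) (hQ : Q.PosSemidef) :
    (pairLaw μ X₁ X₂).map (stackEquiv p₁ p₂) = multivariateGaussian 0 Q := by
  rw [pairLaw, AEMeasurable.map_map_of_aemeasurable (by fun_prop) hX.gaussian.aemeasurable]
  exact map_eq_multivariateGaussian (hX.gaussian.map_equiv (stackEquiv p₁ p₂)) hQ
    hX.integral_stack hX.cov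

lemma map_fst (hX : IsCenteredGaussianPair μ X₁ X₂ Q) (hQ : Q.PosSemidef) :
    μ.map X₁ = multivariateGaussian 0 Q.toBlocks₁₁ :=
  map_eq_multivariateGaussian hX.gaussian.fst (hQ.submatrix Sum.inl)
    (fun i => hX.integral_stack (Sum.inl i)) fun i j => hX.cov (Sum.inl i) (Sum.inl j)

lemma map_snd (hX : IsCenteredGaussianPair μ X₁ X₂ Q) (hQ : Q.PosSemidef) :
    μ.map X₂ = multivariateGaussian 0 Q.toBlocks₂₂ :=
  map_eq_multivariateGaussian hX.gaussian.snd (hQ.submatrix Sum.inr)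
    (fun i => hX.integral_stack (Sum.inr i)) fun i j => hX.cov (Sum.inr i) (Sum.inr j)

lemma pairLaw_fst (hX : IsCenteredGaussianPair μ X₁ X₂ Q) :
    (pairLaw μ X₁ X₂).fst = μ.map X₁ := by
  rw [pairLaw, Measure.fst, AEMeasurable.map_map_of_aemeasurable (by fun_prop)
    hX.gaussian.aemeasurable]
  rfl

lemma pairLaw_snd (hX : IsCenteredGaussianPair μ X₁ X₂ Q) :
    (pairLaw μ X₁ X₂).snd = μ.map X₂ := by
  rw [pairLaw, Measure.snd, AEMeasurable.map_map_of_aemeasurable (by fun_prop)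
    hX.gaussian.aemeasurable]
  rfl

end IsCenteredGaussianPair

lemma det_equalBlockDiag_eq_zero (hp₁ : 0 < p₁) (hp₂ : 0 < p₂) {Δ₁ Δ₂ : ℝ}
    (h0 : Δ₁ = 0 ∨ Δ₂ = 0) : (equalBlockDiag p₁ p₂ Δ₁ Δ₂).det = 0 := by
  rw [equalBlockDiag_eq_diagonal, det_diagonal]
  rcases h0 with rfl | rfl
  · exact Finset.prod_eq_zero (Finset.mem_univ (Sum.inl ⟨0, hp₁⟩)) (by simp [blockLevels])
  · exact Finset.prod_eq_zero (Finset.mem_univ (Sum.inr ⟨0, hp₂⟩)) (by simp [blockLevels])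

lemma coe_ofReal_of_nonneg {x : ℝ} (hx : 0 ≤ x) : ((ENNReal.ofReal x : ℝ≥0∞) : EReal) = x := by
  rw [EReal.coe_ennreal_ofReal, max_eq_left hx]

end Source

end JointRDF

end

/-! ### The main theorem -/

theorem mainTheorem2 {Ω : Type*} [MeasurableSpace Ω] (μ : Measure Ω) [IsProbabilityMeasure μ]
    {p₁ p₂ : ℕ} (hp₁ : 0 < p₁) (hp₂ : 0 < p₂)
    (X₁ : Ω → JointRDF.Vec p₁) (X₂ : Ω → JointRDF.Vec p₂) (Q : JointRDF.BlockMat p₁ p₂)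
    (hX : JointRDF.IsCenteredGaussianPair μ X₁ X₂ Q) (hQ : Q.PosDef) (Δ₁ Δ₂ : ℝ) :
    ((Δ₁, Δ₂) ∈ JointRDF.positiveRegion Q →
      (JointRDF.sqJointRdf (JointRDF.pairLaw μ X₁ X₂) Δ₁ Δ₂ : EReal) =
        JointRDF.halfLogRatio Q.det
          ((JointRDF.equalDiag p₁ Δ₁).det * (JointRDF.equalDiag p₂ Δ₂).det) ∧
      (JointRDF.sqJointRdf (JointRDF.pairLaw μ X₁ X₂) Δ₁ Δ₂ : EReal) =
        (JointRDF.sqRdf (μ.map X₁) Δ₁ : EReal) + (JointRDF.sqRdf (μ.map X₂) Δ₂ : EReal) -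
          (JointRDF.mutualInfo (JointRDF.pairLaw μ X₁ X₂) : EReal) ∧
      (JointRDF.sqJointRdf (JointRDF.pairLaw μ X₁ X₂) Δ₁ Δ₂ < ∞ →
        (∀ S, JointRDF.IsOptimalErrorCov Q Δ₁ Δ₂ S ↔
          S = JointRDF.equalBlockDiag p₁ p₂ Δ₁ Δ₂) ∧
        (Q - JointRDF.equalBlockDiag p₁ p₂ Δ₁ Δ₂).PosDef ∧
        JointRDF.AchievedByErrorCov (JointRDF.pairLaw μ X₁ X₂) Δ₁ Δ₂
          (JointRDF.equalBlockDiag p₁ p₂ Δ₁ Δ₂))) ∧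
    (0 ≤ Δ₁ → 0 ≤ Δ₂ → (Q - JointRDF.equalBlockDiag p₁ p₂ Δ₁ Δ₂).PosDef →
      (Δ₁, Δ₂) ∈ JointRDF.positiveRegion Q ∧
      JointRDF.IsOptimalErrorCov Q Δ₁ Δ₂ (JointRDF.equalBlockDiag p₁ p₂ Δ₁ Δ₂) ∧
      JointRDF.AchievedByErrorCov (JointRDF.pairLaw μ X₁ X₂) Δ₁ Δ₂
        (JointRDF.equalBlockDiag p₁ p₂ Δ₁ Δ₂)) := by
  have hP := hX.map_stackEquiv hQ.posSemidef
  have hQ₁ : Q.toBlocks₁₁.PosDef := hQ.submatrix Sum.inl_injective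
  have hQ₂ : Q.toBlocks₂₂.PosDef := hQ.submatrix Sum.inr_injective
  have hm₁ := hX.map_fst hQ.posSemidef
  have hm₂ := hX.map_snd hQ.posSemidef
  have hP₁ := hX.pairLaw_fst.trans hm₁
  have hP₂ := hX.pairLaw_snd.trans hm₂
  obtain ⟨hI, hI0⟩ := JointRDF.mutualInfo_pair hQ hP hP₁ hP₂ hQ₁ hQ₂
  have htop : ∀ {π}, Δ₁ = 0 ∨ Δ₂ = 0 →
      π ∈ JointRDF.jointAdmissible (JointRDF.pairLaw μ X₁ X₂) JointRDF.sqDist JointRDF.sqDist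
        Δ₁ Δ₂ → JointRDF.mutualInfo π = ∞ := fun h0 hπ =>
    JointRDF.mutualInfo_eq_top_of_mem_jointAdmissible hp₁ hp₂ hQ₁ hQ₂ hP₁ hP₂ h0 hπ
  have htop' : Δ₁ = 0 ∨ Δ₂ = 0 →
      JointRDF.sqJointRdf (JointRDF.pairLaw μ X₁ X₂) Δ₁ Δ₂ = ∞ := fun h0 =>
    iInf₂_eq_top.2 fun π hπ => htop h0 hπ
  constructor
  · rintro ⟨hΔ₁, hΔ₂, S, hS, hQS⟩
    simp only at hΔ₁ hΔ₂ hS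
    by_cases h0 : Δ₁ = 0 ∨ Δ₂ = 0
    · rw [htop' h0]
      refine ⟨?_, ?_, fun h => absurd h (lt_irrefl _)⟩
      · rw [← JointRDF.det_equalBlockDiag, JointRDF.halfLogRatio_eq_top hQ.det_pos
          (JointRDF.det_equalBlockDiag_eq_zero hp₁ hp₂ h0).le]
        rfl
      -- Since I(X₁; X₂) is finite, subtracting it from the infinite sum of marginal rates still
      -- gives `⊤`.
      · rw [hm₁, hm₂, hI, JointRDF.coe_ofReal_of_nonneg hI0]
        rcases h0 with rfl | rfl
        · rw [JointRDF.sqRdf_multivariateGaussian_zero hp₁ hQ₁, EReal.coe_ennreal_top,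
            EReal.top_add_of_ne_bot (EReal.coe_ennreal_ne_bot _), EReal.top_sub_coe]
        · rw [JointRDF.sqRdf_multivariateGaussian_zero hp₂ hQ₂, EReal.coe_ennreal_top,
            EReal.add_top_of_ne_bot (EReal.coe_ennreal_ne_bot _), EReal.top_sub_coe]
    · push Not at h0
      have hΔ₁' := hΔ₁.lt_of_ne' h0.1
      have hΔ₂' := hΔ₂.lt_of_ne' h0.2
      obtain rfl := JointRDF.eq_equalBlockDiag_of_isOptimal hp₁ hp₂ hΔ₁' hΔ₂' hQ hS hQS
      have hd₁ := JointRDF.posDef_equalDiag hp₁ hΔ₁'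
      have hd₂ := JointRDF.posDef_equalDiag hp₂ hΔ₂'
      have hD := JointRDF.posDef_equalBlockDiag hp₁ hp₂ hΔ₁' hΔ₂'
      obtain ⟨hR, hach⟩ := JointRDF.sqJointRdf_eq hp₁ hp₂ hΔ₁' hΔ₂' hQ hP hQS.posSemidef
      have hR0 := (JointRDF.mutualInfo_gaussianChannel hQ hD hQS.posSemidef).2
      -- The marginal feasibility conditions hold because the diagonal blocks of `Q - D` are
      -- principal submatrices.
      obtain ⟨hR₁, hR₁0⟩ := JointRDF.sqRdf_multivariateGaussian hp₁ hΔ₁' hQ₁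
        (hQS.posSemidef.submatrix Sum.inl)
      obtain ⟨hR₂, hR₂0⟩ := JointRDF.sqRdf_multivariateGaussian hp₂ hΔ₂' hQ₂
        (hQS.posSemidef.submatrix Sum.inr)
      refine ⟨?_, ?_, fun _ => ⟨fun S => JointRDF.isOptimalErrorCov_iff hp₁ hp₂ hΔ₁' hΔ₂' hQ
        hQS.posSemidef, hQS, JointRDF.achievedByErrorCov_equalBlockDiag hp₁ hp₂ hΔ₁ hΔ₂ hP
        hQS.posSemidef hach⟩⟩
      · rw [hR, JointRDF.coe_ofReal_of_nonneg hR0, ← JointRDF.det_equalBlockDiag,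
          JointRDF.halfLogRatio_of_pos hQ.det_pos hD.det_pos]
      · rw [hR, hm₁, hm₂, hR₁, hR₂, hI, JointRDF.coe_ofReal_of_nonneg hR0,
          JointRDF.coe_ofReal_of_nonneg hR₁0, JointRDF.coe_ofReal_of_nonneg hR₂0,
          JointRDF.coe_ofReal_of_nonneg hI0, ← EReal.coe_add, ← EReal.coe_sub,
          EReal.coe_eq_coe_iff, JointRDF.det_equalBlockDiag,
          Real.log_div hQ.det_pos.ne' (mul_pos hd₁.det_pos hd₂.det_pos).ne',
          Real.log_div hQ₁.det_pos.ne' hd₁.det_pos.ne',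
          Real.log_div hQ₂.det_pos.ne' hd₂.det_pos.ne',
          Real.log_div (mul_pos hQ₁.det_pos hQ₂.det_pos).ne' hQ.det_pos.ne',
          Real.log_mul hd₁.det_pos.ne' hd₂.det_pos.ne',
          Real.log_mul hQ₁.det_pos.ne' hQ₂.det_pos.ne']
        ring
  · intro hΔ₁ hΔ₂ hQS
    have hopt := JointRDF.isOptimalErrorCov_equalBlockDiag hp₁ hp₂ hΔ₁ hΔ₂ hQ hQS.posSemidef
    refine ⟨⟨hΔ₁, hΔ₂, _, hopt, hQS⟩, hopt, JointRDF.achievedByErrorCov_equalBlockDiag hp₁ hp₂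
      hΔ₁ hΔ₂ hP hQS.posSemidef ?_⟩
    by_cases h0 : Δ₁ = 0 ∨ Δ₂ = 0
    · rw [htop' h0]
      -- With a zero distortion level, the infimum `∞` is attained by any admissible law; the
      -- possibly singular test channel is one.
      exact htop h0 (JointRDF.testChannel_mem_jointAdmissible hp₁ hp₂ hΔ₁ hΔ₂ hP hQS.posSemidef)
    · push Not at h0
      exact (JointRDF.sqJointRdf_eq hp₁ hp₂ (hΔ₁.lt_of_ne' h0.1) (hΔ₂.lt_of_ne' h0.2) hQ hP
        hQS.posSemidef).2
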